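/- Let $p,q\ge 1$. Let $C(p,q)$ be the real Clifford algebra of the quadratic form $Q(a)=a_1^2+\dots+a_p^2-a_{p+1}^2-\dots-a_{p+q}^2$ on $E=\mathbb{R}^{p+q}$, with the convention $a\cdot a=Q(a)$ for $a\in E$; let $v_1^+,\dots,v_p^+,v_1^-,\dots,v_q^-$ be the images of the standard basis vectors, and $C_{\mathrm{even}}(p,q)$ the even subalgebra. Let $a\mapsto{}^t a$ be the anti-automorphism of $C(p,q)$ that is the identity on $E$, let $a\mapsto a^*$ be the anti-automorphism with $(v_i^+)^*=v_i^+$ and $(v_j^-)^*=-v_j^-$, and put $J_+=v_1^+\cdots v_p^+$, $J_-=v_1^-\cdots v_q^-$. Define $$G(p,q)=\{a\in C_{\mathrm{even}}(p,q):{}^t a\,a=1\},\qquad \mathrm{Aut}(J_\pm)=\{a\in C(p,q): a^*J_\pm a=J_\pm\}.$$ All groups carry the topology induced from the finite-dimensional real algebra containing them, and $\cong$ between groups means isomorphism of topological (equivalently, Lie) groups. $H^{(2)}$ denotes $H\times H$. $Sp(n,\mathbb{R})$ and $Sp(n,\mathbb{C})$ consist of $2n\times 2n$ matrices, $O^*(4n)$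 is the isometry group of the non-degenerate quaternionic skew-Hermitian form on $\mathbb{H}^{2n}$, and $Sp(n,n)$ that of the quaternionic Hermitian form of signature $(n,n)$. **(A)** The algebra $C_{\mathrm{even}}(p,q)$ and the group $G(p,q)$ are, up to isomorphism, given by the following table, in which $n=2^{(p+q-\alpha)/2}$ (an integer, except that $n=\tfrac12$ if $p=q=1$, where only $2n$ occurs): $$\begin{array}{c|c|c|c|l} p-q \bmod 8 & \alpha & C_{\mathrm{even}}(p,q) & p+q \bmod 8 & G(p,q)\\ \hline 0 & 4 & M(2n,\mathbb{R})\oplus M(2n,\mathbb{R}) & 0 & O(n,n)^{(2)}\\ & & & \pm2 & GL(2n,\mathbb{R})\\ & & & 4 & Sp(n,\mathbb{R})^{(2)}\\ \hline \pm1 & 3 & M(2n,\mathbb{R}) & \pm1 & O(n,n)\\ & & & \pm3 & Sp(n,\mathbb{R})\\ \hline \pm2 & 4 & M(2n,\mathbb{C}) & 0 & O(2n,\mathbb{C})\\ & & & \pm2 & U(n,n)\\ & & & 4 & Sp(n,\mathbb{C})\\ \hline \pm3 & 5 & M(2n,\mathbb{H}) & \pm1 & O^*(4n)\\ & & & \pm3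 & Sp(n,n)\\ \hline 4 & 6 & M(2n,\mathbb{H})\oplus M(2n,\mathbb{H}) & 0 & O^*(4n)^{(2)}\\ & & & \pm2 & GL(2n,\mathbb{H})\\ & & & 4 & Sp(n,n)^{(2)} \end{array}$$ Thus the type of $G(p,q)$ depends only on $p-q$ and $p+q$ modulo $8$. **(B)** Put $n=2^{(p+q-\alpha)/2}$ with $\alpha$ as in the following table. The group $C(p,q)\cap\mathrm{Aut}(J_+)=\mathrm{Aut}(J_+)$ is isomorphic to $$\begin{array}{c|c|c|c} p-q-1 \bmod 8 & \alpha & p\bmod 4\in\{0,1\} & p\bmod 4\in\{2,3\}\\ \hline 0 & 3 & O(n,n)^{(2)} & Sp(n,\mathbb{R})^{(2)}\\ \pm1 & 2 & O(n,n) & Sp(n,\mathbb{R})\\ \pm2 & 3 & U(n,n) & U(n,n)\\ \pm3 & 4 & Sp(n,n) & O^*(4n)\\ 4 & 5 & Sp(n,n)^{(2)} & O^*(4n)^{(2)} \end{array}$$ The group $C(p,q)\cap\mathrm{Aut}(J_-)=\mathrm{Aut}(J_-)$ is given by the same table with $p \bmod 4$ replaced by $q+1 \bmod 4$ (and $p-q-1$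 and $\alpha$ unchanged). **(C)** If $p$ and $q$ are odd, then $G(p,q)=C_{\mathrm{even}}(p,q)\cap\mathrm{Aut}(J_+)=C_{\mathrm{even}}(p,q)\cap\mathrm{Aut}(J_-)$, and with $n=2^{(p+q-\alpha)/2}$ this group is isomorphic to: $GL(n,\mathbb{R})$, $\alpha=2$, if $p-q\equiv0 \bmod 8$; $GL(n,\mathbb{H})$, $\alpha=4$, if $p-q\equiv4\bmod 8$ (in both cases $p+q\equiv\pm2 \bmod 8$); $O(n,\mathbb{C})$, $\alpha=2$, if $p-q\equiv\pm2$ and $p+q\equiv0\bmod 8$; $Sp(n,\mathbb{C})$, $\alpha=4$, if $p-q\equiv\pm2$ and $p+q\equiv4\bmod 8$. -/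

import Mathlib

open CliffordAlgebra
open scoped Quaternion

noncomputable section

namespace IndefClifford

/-! ## The Clifford algebra `C(p,q)` -/

/-- The quadratic form `Q(a) = ∑_{i<p} (aᵢ⁺)² - ∑_{j<q} (aⱼ⁻)²` on `ℝ^{p+q}`; coordinates are indexed by
`Fin p ⊕ Fin q`, the first summand carrying the positive directions. -/
abbrev stdForm (p q : ℕ) : QuadraticForm ℝ (Fin p ⊕ Fin q → ℝ) :=
  QuadraticMap.weightedSumSquares ℝ (Sum.elim (fun _ => (1 : ℝ)) (fun _ => (-1 : ℝ)))

/-- The Clifford algebra `C(p,q)`, generated by `ℝ^{p+q}` with the relations `a * a = Q(a)`. -/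
abbrev Cl (p q : ℕ) : Type := CliffordAlgebra (stdForm p q)

/-- `C(p,q)` carries its topology as a finite-dimensional real vector space. -/
instance (p q : ℕ) : TopologicalSpace (Cl p q) := moduleTopology ℝ (Cl p q)

instance (p q : ℕ) : IsModuleTopology ℝ (Cl p q) := ⟨rfl⟩

/-- The even subalgebra `C_even(p,q)`. -/
abbrev ClEven (p q : ℕ) : Subalgebra ℝ (Cl p q) := CliffordAlgebra.even (stdForm p q)

/-- The generator `v⁺ᵢ`. -/
def vPlus {p q : ℕ} (i : Fin p) : Cl p q := ι (stdForm p q) (Pi.single (Sum.inl i) 1)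

/-- The generator `v⁻ⱼ`. -/
def vMinus {p q : ℕ} (j : Fin q) : Cl p q := ι (stdForm p q) (Pi.single (Sum.inr j) 1)

/-- `J₊ = v⁺₁ ⋯ v⁺ₚ`. -/
def JPlus (p q : ℕ) : Cl p q := (List.ofFn fun i : Fin p => vPlus i).prod

/-- `J₋ = v⁻₁ ⋯ v⁻_q`. -/
def JMinus (p q : ℕ) : Cl p q := (List.ofFn fun j : Fin q => vMinus j).prod

/-- The isometry of `ℝ^{p,q}` that fixes every `v⁺ᵢ` and sends every `v⁻ⱼ` to `-v⁻ⱼ`. -/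
def flipMinus (p q : ℕ) : stdForm p q →qᵢ stdForm p q where
  toFun x := Sum.elim (fun i => x (Sum.inl i)) (fun j => -x (Sum.inr j))
  map_add' x y := by
    ext k; rcases k with i | j
    · simp
    · simp [add_comm]
  map_smul' c x := by
    ext k; rcases k with i | j <;> simp
  map_app' x := by
    simp [QuadraticMap.weightedSumSquares_apply]

theorem flipMinus_apply {p q : ℕ} (x : Fin p ⊕ Fin q → ℝ) :
    flipMinus p q x = Sum.elim (fun i => x (Sum.inl i)) (fun j => -x (Sum.inr j)) := rfl

/-- The algebra automorphism `T_{0,q}` of `C(p,q)` with `v⁺ᵢ ↦ v⁺ᵢ` and `v⁻ⱼ ↦ -v⁻ⱼ`. -/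
def TMinus (p q : ℕ) : Cl p q →ₐ[ℝ] Cl p q := CliffordAlgebra.map (flipMinus p q)

/-- The anti-automorphism `a ↦ a* = T_{0,q}(ᵗa)`, where `ᵗa` is `CliffordAlgebra.reverse a`. -/
def starConj {p q : ℕ} (a : Cl p q) : Cl p q := TMinus p q (reverse a)

theorem starConj_one {p q : ℕ} : starConj (1 : Cl p q) = 1 := by
  simp [starConj]

theorem starConj_mul {p q : ℕ} (a b : Cl p q) :
    starConj (a * b) = starConj b * starConj a := by
  simp [starConj]

/-! ## The groups inside `C(p,q)`

Each is the set in question with the multiplication of `C(p,q)` and the subspace topology. -/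

/-- `G(p,q) = {a ∈ C_even(p,q) : ᵗa a = 1}`. -/
def G (p q : ℕ) : Submonoid (Cl p q) where
  carrier := {a | a ∈ ClEven p q ∧ reverse a * a = 1}
  one_mem' := ⟨one_mem _, by simp⟩
  mul_mem' := by
    rintro a b ⟨ha, ha'⟩ ⟨hb, hb'⟩
    refine ⟨mul_mem ha hb, ?_⟩
    rw [reverse.map_mul, mul_assoc, ← mul_assoc _ a b, ha', one_mul, hb']

/-- `{a ∈ C(p,q) : a* J a = J}`; this is `Aut(J₊)` for `J = J₊` and `Aut(J₋)` for `J = J₋`. -/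
def AutJ {p q : ℕ} (J : Cl p q) : Submonoid (Cl p q) where
  carrier := {a | starConj a * J * a = J}
  one_mem' := by simp [starConj_one]
  mul_mem' := by
    intro a b (ha : _ = _) (hb : _ = _)
    change starConj (a * b) * J * (a * b) = J
    calc starConj (a * b) * J * (a * b)
        = starConj b * (starConj a * J * a) * b := by rw [starConj_mul]; noncomm_ring
      _ = J := by rw [ha, hb]

/-! ## Classical groups -/

/-- Matrices over `F` that preserve the sesquilinear form `(x, y) ↦ x* B y`. -/
def formGroup {m F : Type*} [Fintype m] [DecidableEq m] [Ring F] [StarRing F]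
    (B : Matrix m m F) : Submonoid (Matrix m m F) where
  carrier := {A | A.conjTranspose * B * A = B}
  one_mem' := by simp
  mul_mem' := by
    intro X Y (hX : _ = _) (hY : _ = _)
    change (X * Y).conjTranspose * B * (X * Y) = B
    calc (X * Y).conjTranspose * B * (X * Y)
        = Y.conjTranspose * (X.conjTranspose * B * X) * Y := by
          rw [Matrix.conjTranspose_mul]; simp only [Matrix.mul_assoc]
      _ = B := by rw [hX, hY]

/-- The matrix `diag(1,…,1,-1,…,-1)` with `n` entries of each sign. -/
def signMatrix (n : ℕ) (F : Type*) [Ring F] : Matrix (Fin n ⊕ Fin n) (Fin n ⊕ Fin n) F :=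
  Matrix.fromBlocks 1 0 0 (-1)

/-- `O(n,n)` (over `ℝ` the conjugate transpose is the transpose). -/
abbrev Onn (n : ℕ) : Submonoid (Matrix (Fin n ⊕ Fin n) (Fin n ⊕ Fin n) ℝ) :=
  formGroup (signMatrix n ℝ)

/-- `U(n,n)`. -/
abbrev Unn (n : ℕ) : Submonoid (Matrix (Fin n ⊕ Fin n) (Fin n ⊕ Fin n) ℂ) :=
  formGroup (signMatrix n ℂ)

/-- `Sp(n,n)`: the isometries of the quaternionic Hermitian form of signature `(n,n)`. -/
abbrev Spnn (n : ℕ) : Submonoid (Matrix (Fin n ⊕ Fin n) (Fin n ⊕ Fin n) ℍ[ℝ]) :=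
  formGroup (signMatrix n ℍ[ℝ])

/-- `O*(2m)`: the isometries of the quaternionic skew-Hermitian form `∑ x̄ᵢ 𝐣 yᵢ` on `ℍᵐ`. -/
abbrev OStar (m : ℕ) : Submonoid (Matrix (Fin m) (Fin m) ℍ[ℝ]) :=
  formGroup (Matrix.diagonal fun _ => (⟨0, 0, 1, 0⟩ : ℍ[ℝ]))

/-- `Sp(n,ℝ)`, inside the `2n × 2n` matrices. -/
abbrev SpR (n : ℕ) : Submonoid (Matrix (Fin n ⊕ Fin n) (Fin n ⊕ Fin n) ℝ) :=
  Matrix.symplecticGroup (Fin n) ℝ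

/-- `Sp(n,ℂ)`, inside the `2n × 2n` matrices. -/
abbrev SpC (n : ℕ) : Submonoid (Matrix (Fin n ⊕ Fin n) (Fin n ⊕ Fin n) ℂ) :=
  Matrix.symplecticGroup (Fin n) ℂ

/-- `O(m,ℂ) = {A : A Aᵀ = 1}` (the transpose, not the conjugate transpose). -/
abbrev OC (m : ℕ) : Submonoid (Matrix (Fin m) (Fin m) ℂ) := Matrix.orthogonalGroup (Fin m) ℂ

theorem mem_OC_iff {m : ℕ} {A : Matrix (Fin m) (Fin m) ℂ} :
    A ∈ OC m ↔ A * A.transpose = 1 := Matrix.mem_orthogonalGroup_iff (Fin m) ℂ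

/-- `GL(m,ℝ)`. -/
abbrev GLR (m : ℕ) : Type := (Matrix (Fin m) (Fin m) ℝ)ˣ

/-- `GL(m,ℍ)`. -/
abbrev GLH (m : ℕ) : Type := (Matrix (Fin m) (Fin m) ℍ[ℝ])ˣ

/-! ## Isomorphism and congruences -/

/-- There is an isomorphism of topological groups. All groups here are closed subgroups of the unit
groups of finite-dimensional real algebras, so this is the same as isomorphism of Lie groups. -/
abbrev LieIso (A B : Type*) [Mul A] [Mul B] [TopologicalSpace A] [TopologicalSpace B] : Prop :=
  Nonempty (A ≃ₜ* B)

/-- There is an isomorphism of unital `ℝ`-algebras. -/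
abbrev AlgIso (A B : Type*) [Ring A] [Ring B] [Algebra ℝ A] [Algebra ℝ B] : Prop :=
  Nonempty (A ≃ₐ[ℝ] B)

/-- `x ≡ ± r (mod 8)`. -/
abbrev PM8 (x r : ℤ) : Prop := x ≡ r [ZMOD 8] ∨ x ≡ -r [ZMOD 8]

/-- The `m × m` matrix algebra over `F`. -/
abbrev Mat (m : ℕ) (F : Type) : Type := Matrix (Fin m) (Fin m) F

/-- The list of isomorphism types of `C(p,q) ∩ Aut(J)`, depending on `p`, `q` and on a sign: the sign
condition `herm` says that `J² = 1` and `skew` that `J² = -1`, expressed by congruences mod 4. -/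
def AutTable (p q : ℕ) (H : Submonoid (Cl p q)) (herm skew : Prop) : Prop :=
  ((p : ℤ) - q - 1 ≡ 0 [ZMOD 8] → ∃ m n : ℕ, p + q = 2 * m + 3 ∧ n = 2 ^ m ∧
    (herm → LieIso H (Onn n × Onn n)) ∧ (skew → LieIso H (SpR n × SpR n))) ∧
  (PM8 ((p : ℤ) - q - 1) 1 → ∃ m n : ℕ, p + q = 2 * m + 2 ∧ n = 2 ^ m ∧
    (herm → LieIso H (Onn n)) ∧ (skew → LieIso H (SpR n))) ∧
  (PM8 ((p : ℤ) - q - 1) 2 → ∃ m n : ℕ, p + q = 2 * m + 3 ∧ n = 2 ^ m ∧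
    LieIso H (Unn n)) ∧
  (PM8 ((p : ℤ) - q - 1) 3 → ∃ m n : ℕ, p + q = 2 * m + 4 ∧ n = 2 ^ m ∧
    (herm → LieIso H (Spnn n)) ∧ (skew → LieIso H (OStar (2 * n)))) ∧
  ((p : ℤ) - q - 1 ≡ 4 [ZMOD 8] → ∃ m n : ℕ, p + q = 2 * m + 5 ∧ n = 2 ^ m ∧
    (herm → LieIso H (Spnn n × Spnn n)) ∧
    (skew → LieIso H (OStar (2 * n) × OStar (2 * n))))

end IndefClifford

end

/-!
A Clifford algebra with `p, q ≥ 1` consists of the `2 × 2` matrices over a smaller one: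
`C(p+1,q+1) ≅ M₂(C(p,q))`, and `a ↦ a*` becomes the conjugate transpose, because the generators of
`C(p+1,q+1)` go to matrices that are Hermitian if their square is `1` and skew-Hermitian if it is
`-1`. With `C(p+1,q) ≅ C(q+1,p)` and `C(p,q+4) ≅ C(q,p+4)`, again compatible with `*`, this reduces
the classification of the algebras with involution `(C(p,q), *)` to five small cases, and they are
the full matrix algebras over `ℝ`, `ℂ`, `ℍ`, `ℝ × ℝ` and `ℍ × ℍ` with the conjugate transpose.

The element `J₊` or `J₋` anticommutes or commutes with the generators just as `v⁺₁` or `v⁻₁` would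
after the remaining generators have been corrected by the factor `v⁺₁v⁻₁`. So the doubling
isomorphism can be chosen to take `J₊` to `diag(1, -1)` or to the skew matrix, according to the sign
of `J₊²`, and `Aut(J₊)` is the isometry group of a standard Hermitian or skew-Hermitian form.

Further `C_even(p,q+1) ≅ C(p,q)`, where the transposition of `C_even` becomes the conjugation
`a ↦ ā` with `v̄ = -v`, so that `G(p,q+1)` is the group `ā a = 1` in `C(p,q)`. If `q` is odd, then
`J₋` turns `*` into the conjugation and `G(p,q+1) = Aut(J₋)`; `p` and `q + 1` can be interchanged.
If `p` and `q + 1` are odd, the centre of `C(p,q)` contains `w = J₊J₋`. For `w² = 1` the conjugation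
exchanges the two factors of `C(p,q)`, and the group consists of the units of one factor. For
`w² = -1` it fixes `w`, so it is `ℂ`-linear, `C(p,q) ≅ ℂ ⊗ C(l+1,l+1)` with `2l + 3 = p + q`, and
the group preserves the complexification of a real symmetric or symplectic form.
-/

noncomputable section

namespace IndefClifford

section Frames

variable {A : Type*} [Ring A] [StarRing A] [Algebra ℝ A] {I K : Type*} {s : I → ℝ} {z : I → A}

/-- Pairwise anticommuting elements with `zᵢ² = sᵢ = ±1` and `zᵢ* = sᵢ zᵢ`: the images of an
orthonormal basis under a `*`-representation of a real Clifford algebra. -/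
structure IsFrame (s : I → ℝ) (z : I → A) : Prop where
  sign_mul_self : ∀ i, s i * s i = 1
  mul_self : ∀ i, z i * z i = s i • 1
  star_eq : ∀ i, star (z i) = s i • z i
  anticomm : ∀ i j, i ≠ j → z j * z i = -(z i * z j)

theorem IsFrame.comp (h : IsFrame s z) {f : K → I} (hf : Function.Injective f) :
    IsFrame (s ∘ f) (z ∘ f) where
  sign_mul_self _ := h.sign_mul_self _
  mul_self _ := h.mul_self _
  star_eq _ := h.star_eq _
  anticomm _ _ hij := h.anticomm _ _ (hf.ne hij)

theorem IsFrame.congr {t : I → ℝ} (h : IsFrame s z) (e : ∀ i, s i = t i) : IsFrame t z := by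
  rwa [← funext e]

theorem IsFrame.twist [StarModule ℝ A] (h : IsFrame s z) (T : I → Prop) [DecidablePred T] {g : A}
    {γ δ : ℝ} (hγ : γ * γ = 1) (hδ : δ * δ = 1) (hg : g * g = γ • 1) (hgs : star g = γ • g)
    (hT : ∀ i, T i → g * z i = δ • (z i * g)) (hT' : ∀ i, ¬ T i → g * z i = z i * g) :
    IsFrame (fun i => if T i then δ * γ * s i else s i)
      (fun i => if T i then z i * g else z i) where
  sign_mul_self i := by
    split_ifs
    · linear_combination (γ * γ * s i * s i) * hδ + s i * s i * hγ + h.sign_mul_self i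
    · exact h.sign_mul_self i
  mul_self i := by
    split_ifs with hi
    · calc z i * g * (z i * g) = z i * (g * z i) * g := by simp only [mul_assoc]
        _ = δ • ((z i * z i) * (g * g)) := by
          rw [hT i hi, mul_smul_comm, smul_mul_assoc]; simp only [mul_assoc]
        _ = (δ * γ * s i) • 1 := by
          rw [h.mul_self, hg, smul_mul_smul_comm, mul_one, smul_smul]; congr 1; ring
    · exact h.mul_self i
  star_eq i := by
    split_ifs with hi
    · rw [star_mul, hgs, h.star_eq, smul_mul_assoc, mul_smul_comm, hT i hi, smul_smul, smul_smul]
      congr 1; ring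
    · exact h.star_eq i
  anticomm i j hij := by
    have zz := h.anticomm i j hij
    split_ifs with hj hi hi
    · calc z j * g * (z i * g) = z j * (g * z i) * g := by simp only [mul_assoc]
        _ = δ • ((z j * z i) * (g * g)) := by
          rw [hT i hi, mul_smul_comm, smul_mul_assoc]; simp only [mul_assoc]
        _ = -(z i * (δ • (z j * g)) * g) := by
          rw [zz, mul_smul_comm, smul_mul_assoc, neg_mul, smul_neg]; simp only [mul_assoc]
        _ = -(z i * g * (z j * g)) := by rw [← hT j hj]; simp only [mul_assoc]
    · rw [mul_assoc, hT' i hi, ← mul_assoc, zz, neg_mul, mul_assoc]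
    · rw [← mul_assoc, zz, neg_mul, mul_assoc, mul_assoc, hT' j hj]
    · exact zz

/-- The signs of the standard basis of `ℝ^{p,q}`. -/
abbrev stdSign (p q : ℕ) : Fin p ⊕ Fin q → ℝ := Sum.elim (fun _ => 1) (fun _ => -1)

/-- A family indexed as the standard basis of `ℝ^{p,q}`, extended to the index set of
`ℝ^{p+1,q+1}` by `a` in front of the positive part and `b` in front of the negative part. -/
def consPair {p q : ℕ} (a b : A) (y : Fin p ⊕ Fin q → A) : Fin (p + 1) ⊕ Fin (q + 1) → A :=
  Sum.elim (Fin.cons a (y ∘ Sum.inl)) (Fin.cons b (y ∘ Sum.inr))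

theorem isFrame_consPair {p q : ℕ} {a b : A} {y : Fin p ⊕ Fin q → A}
    (hy : IsFrame (stdSign p q) y) (ha : a * a = 1) (hb : b * b = -1) (ha' : star a = a)
    (hb' : star b = -b) (hab : b * a = -(a * b)) (hay : ∀ i, y i * a = -(a * y i))
    (hby : ∀ i, y i * b = -(b * y i)) :
    IsFrame (stdSign (p + 1) (q + 1)) (consPair a b y) where
  sign_mul_self := by rintro (i | i) <;> norm_num
  mul_self := by
    rintro (i | i) <;> refine Fin.cases ?_ (fun i => ?_) i
    · simpa [consPair]
    · simpa [consPair] using hy.mul_self (.inl i)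
    · simpa [consPair]
    · simpa [consPair] using hy.mul_self (.inr i)
  star_eq := by
    rintro (i | i) <;> refine Fin.cases ?_ (fun i => ?_) i
    · simpa [consPair]
    · simpa [consPair] using hy.star_eq (.inl i)
    · simpa [consPair]
    · simpa [consPair] using hy.star_eq (.inr i)
  anticomm := by
    have yy {i j} (h : i ≠ j) : y j * y i = -(y i * y j) := hy.anticomm i j h
    rintro (i | i) (j | j) <;> refine Fin.cases ?_ (fun i => ?_) i <;>
      refine Fin.cases ?_ (fun j => ?_) j <;> intro hij <;>
      simp only [consPair, Sum.elim_inl, Sum.elim_inr, Fin.cons_zero, Fin.cons_succ,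
        Function.comp_apply] <;>
      first
      | exact absurd rfl hij
      | simp only [hab, hay, hby, neg_neg]
      | exact yy (by simp_all)

end Frames

section OrderedProducts

variable {A : Type*} [Ring A] [Algebra ℝ A]

theorem mul_prod_ofFn {n : ℕ} {y : Fin n → A} {v : A} {c : Fin n → ℝ}
    (h : ∀ j, v * y j = c j • (y j * v)) :
    v * (List.ofFn y).prod = (∏ j, c j) • ((List.ofFn y).prod * v) := by
  induction n with
  | zero => simp
  | succ n ih =>
    rw [List.ofFn_succ, List.prod_cons, ← mul_assoc, h, smul_mul_assoc, mul_assoc,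
      ih (c := fun j => c j.succ) (fun j => h j.succ), Fin.prod_univ_succ, mul_smul_comm, smul_smul,
      mul_assoc]

theorem mul_prod_ofFn_anticomm {n : ℕ} {y : Fin n → A} {v : A} (h : ∀ j, v * y j = -(y j * v)) :
    v * (List.ofFn y).prod = (-1 : ℝ) ^ n • ((List.ofFn y).prod * v) := by
  rw [mul_prod_ofFn (c := fun _ => -1) (by simpa using h)]
  simp

theorem prod_ofFn_mul_anticomm {n : ℕ} {y : Fin n → A} {v : A} (h : ∀ j, v * y j = -(y j * v)) :
    (List.ofFn y).prod * v = (-1 : ℝ) ^ n • (v * (List.ofFn y).prod) := by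
  rw [mul_prod_ofFn_anticomm h, smul_smul, ← mul_pow, neg_one_mul, neg_neg, one_pow, one_smul]

theorem prod_ofFn_mul_self {n : ℕ} {y : Fin (n + 1) → A}
    (h : ∀ i j, i ≠ j → y j * y i = -(y i * y j)) (k : Fin (n + 1)) :
    (List.ofFn y).prod * y k = (-1 : ℝ) ^ n • (y k * (List.ofFn y).prod) := by
  have key : y k * (List.ofFn y).prod = (-1 : ℝ) ^ n • ((List.ofFn y).prod * y k) := by
    rw [mul_prod_ofFn (c := fun j => if j = k then 1 else -1)]
    · simp [Finset.prod_ite, Finset.filter_ne']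
    · intro j
      split_ifs with hj
      · simp [hj]
      · simpa using h j k hj
  rw [key, smul_smul, ← mul_pow, neg_one_mul, neg_neg, one_pow, one_smul]

/-- The sign `c^n (-1)^{n(n-1)/2}` of the square of a product of `n` anticommuting elements with
square `c = ±1`. -/
def prodSign (c : ℝ) (n : ℕ) : ℝ := c ^ n * (-1) ^ n.choose 2

theorem prodSign_succ (c : ℝ) (n : ℕ) : prodSign c (n + 1) = prodSign c n * c * (-1) ^ n := by
  simp only [prodSign, Nat.choose_succ_succ' n 1, Nat.choose_one_right, pow_add, pow_one]
  ring

theorem prodSign_mod_four {c : ℝ} (hc : c * c = 1) (n : ℕ) : prodSign c n = prodSign c (n % 4) := by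
  have add_four (n : ℕ) : prodSign c (n + 4) = prodSign c n := by
    have hn : (-1 : ℝ) ^ n * (-1) ^ n = 1 := by rw [← mul_pow]; norm_num
    simp only [prodSign_succ, pow_succ]
    calc _ = prodSign c n * (c * c) ^ 2 * ((-1) ^ n * (-1) ^ n) ^ 2 := by ring
      _ = prodSign c n := by rw [hc, hn]; ring
  conv_lhs => rw [← Nat.mod_add_div n 4]
  induction n / 4 with
  | zero => rfl
  | succ k ih => rw [Nat.mul_succ, ← add_assoc, add_four, ih]

theorem prodSign_one_eq_one {n : ℕ} (h : n % 4 = 0 ∨ n % 4 = 1) : prodSign 1 n = 1 := by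
  rw [prodSign_mod_four (one_mul 1)]
  rcases h with h | h <;> simp [h, prodSign]

theorem prodSign_one_eq_neg_one {n : ℕ} (h : n % 4 = 2 ∨ n % 4 = 3) : prodSign 1 n = -1 := by
  rw [prodSign_mod_four (one_mul 1)]
  rcases h with h | h <;> norm_num [h, prodSign, Nat.choose]

theorem prodSign_neg_one_eq_prodSign_one (n : ℕ) : prodSign (-1) n = prodSign 1 (n + 1) := by
  rw [prodSign_succ, mul_one, prodSign, prodSign, one_pow, one_mul, mul_comm]

theorem prodSign_one_eq_or (n : ℕ) : prodSign 1 n = 1 ∨ prodSign 1 n = -1 := by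
  rcases (by omega : (n % 4 = 0 ∨ n % 4 = 1) ∨ (n % 4 = 2 ∨ n % 4 = 3)) with h | h
  · exact .inl (prodSign_one_eq_one h)
  · exact .inr (prodSign_one_eq_neg_one h)

variable [StarRing A] {n : ℕ} {c : ℝ} {y : Fin n → A}

theorem star_prod_ofFn_mul_self (h : ∀ i, star (y i) * y i = c • 1) :
    star (List.ofFn y).prod * (List.ofFn y).prod = c ^ n • 1 := by
  induction n with
  | zero => simp
  | succ n ih =>
    have tail := ih (y := y ∘ Fin.succ) fun i => h i.succ
    rw [List.ofFn_succ, List.prod_cons, star_mul, mul_assoc, ← mul_assoc (star (y 0)), h,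
      smul_mul_assoc, one_mul, mul_smul_comm]
    change c • (star (List.ofFn (y ∘ Fin.succ)).prod * (List.ofFn (y ∘ Fin.succ)).prod) = _
    rw [tail, smul_smul, pow_succ']

theorem IsFrame.prod_mul_self (h : IsFrame (fun _ => c) y) :
    (List.ofFn y).prod * (List.ofFn y).prod = prodSign c n • 1 := by
  induction n with
  | zero => simp [prodSign]
  | succ n ih =>
    have tail := ih (h.comp (Fin.succ_injective n))
    have comm := prod_ofFn_mul_anticomm (y := y ∘ Fin.succ) (v := y 0)
      (fun j => h.anticomm _ _ (Fin.succ_ne_zero j))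
    rw [List.ofFn_succ, List.prod_cons]
    change y 0 * (List.ofFn (y ∘ Fin.succ)).prod * (y 0 * (List.ofFn (y ∘ Fin.succ)).prod) = _
    rw [mul_assoc, ← mul_assoc _ (y 0), comm, smul_mul_assoc, mul_assoc, tail, mul_smul_comm,
      mul_smul_comm, mul_smul_comm, mul_one, h.mul_self, smul_smul, smul_smul, prodSign_succ]
    congr 1; ring

theorem IsFrame.star_prod [StarModule ℝ A] (h : IsFrame (fun _ => c) y) :
    star (List.ofFn y).prod = prodSign c n • (List.ofFn y).prod := by
  induction n with
  | zero => simp [prodSign]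
  | succ n ih =>
    have tail := ih (h.comp (Fin.succ_injective n))
    have comm := prod_ofFn_mul_anticomm (y := y ∘ Fin.succ) (v := y 0)
      (fun j => h.anticomm _ _ (Fin.succ_ne_zero j))
    rw [List.ofFn_succ, List.prod_cons, star_mul, h.star_eq]
    change star (List.ofFn (y ∘ Fin.succ)).prod * _ = _ • (y 0 * (List.ofFn (y ∘ Fin.succ)).prod)
    rw [tail, smul_mul_smul_comm, comm, smul_smul, prodSign_succ]

end OrderedProducts

section StarClifford

/-- `C(p,q)` with the involution `a ↦ a*`. A type synonym is needed because Mathlib's `star` on a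
Clifford algebra is the conjugation, the anti-automorphism with `v ↦ -v` for every vector `v`. -/
def StarCl (p q : ℕ) : Type := Cl p q

variable {p q : ℕ}

instance : Ring (StarCl p q) := inferInstanceAs (Ring (Cl p q))
instance : Algebra ℝ (StarCl p q) := inferInstanceAs (Algebra ℝ (Cl p q))
instance : TopologicalSpace (StarCl p q) := inferInstanceAs (TopologicalSpace (Cl p q))
instance : IsModuleTopology ℝ (StarCl p q) := inferInstanceAs (IsModuleTopology ℝ (Cl p q))

theorem TMinus_ι (x : Fin p ⊕ Fin q → ℝ) :
    TMinus p q (ι (stdForm p q) x) = ι (stdForm p q) (flipMinus p q x) :=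
  CliffordAlgebra.map_apply_ι _ _

theorem TMinus_TMinus (a : Cl p q) : TMinus p q (TMinus p q a) = a := by
  have : (TMinus p q).comp (TMinus p q) = AlgHom.id ℝ _ := by
    ext x
    simp only [LinearMap.comp_apply, AlgHom.toLinearMap_apply, AlgHom.comp_apply, TMinus_ι,
      AlgHom.id_apply]
    congr 1
    ext (k | k) <;> simp [flipMinus_apply]
  exact DFunLike.congr_fun this a

theorem reverse_TMinus (a : Cl p q) : reverse (TMinus p q a) = TMinus p q (reverse a) := by
  induction a using CliffordAlgebra.induction with
  | algebraMap r => simp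
  | ι x => simp only [TMinus_ι, reverse_ι]
  | mul a b ha hb => simp only [map_mul, reverse.map_mul, ha, hb]
  | add a b ha hb => simp only [map_add, ha, hb]

theorem starConj_starConj (a : Cl p q) : starConj (starConj a) = a := by
  rw [starConj, starConj, reverse_TMinus, TMinus_TMinus, reverse_reverse]

theorem starConj_add (a b : Cl p q) : starConj (a + b) = starConj a + starConj b := by
  simp only [starConj, map_add]

theorem starConj_smul (r : ℝ) (a : Cl p q) : starConj (r • a) = r • starConj a := by
  simp only [starConj, map_smul]

instance : StarRing (StarCl p q) where
  star a := starConj (p := p) (q := q) a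
  star_involutive := starConj_starConj (p := p) (q := q)
  star_mul := starConj_mul (p := p) (q := q)
  star_add := starConj_add (p := p) (q := q)

instance : StarModule ℝ (StarCl p q) where
  star_smul := starConj_smul (p := p) (q := q)

/-- The standard generators `v⁺₁, …, v⁺ₚ, v⁻₁, …, v⁻_q`. -/
def stdGen (p q : ℕ) (i : Fin p ⊕ Fin q) : StarCl p q := ι (stdForm p q) (Pi.single i 1)

theorem stdForm_single (i : Fin p ⊕ Fin q) : stdForm p q (Pi.single i 1) = stdSign p q i := by
  simp [QuadraticMap.weightedSumSquares_apply, Pi.single_apply]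

theorem polar_stdForm_single {i j : Fin p ⊕ Fin q} (hij : i ≠ j) :
    QuadraticMap.polar (stdForm p q) (Pi.single i 1) (Pi.single j 1) = 0 := by
  simp only [QuadraticMap.polar, QuadraticMap.weightedSumSquares_apply, ← Finset.sum_sub_distrib]
  refine Finset.sum_eq_zero fun k _ => ?_
  obtain rfl | hi := eq_or_ne k i
  · simp [hij]
  · simp [hi]

theorem isFrame_stdGen (p q : ℕ) : IsFrame (stdSign p q) (stdGen p q) where
  sign_mul_self := by rintro (i | i) <;> simp
  mul_self i := by
    change ι (stdForm p q) _ * ι (stdForm p q) _ = _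
    rw [ι_sq_scalar, stdForm_single, Algebra.algebraMap_eq_smul_one]
    rfl
  star_eq i := by
    change starConj (ι (stdForm p q) _) = stdSign p q i • ι (stdForm p q) _
    rw [starConj, reverse_ι, TMinus_ι, ← map_smul]
    congr 1
    ext k
    rcases i with i | i <;> rcases k with k | k <;>
      simp [flipMinus_apply, Pi.single_apply, apply_ite (Neg.neg : ℝ → ℝ)]
  anticomm i j hij := by
    refine eq_neg_of_add_eq_zero_left ?_
    change ι (stdForm p q) _ * ι (stdForm p q) _ + ι (stdForm p q) _ * ι (stdForm p q) _ = 0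
    rw [ι_mul_ι_add_swap, polar_stdForm_single hij.symm, map_zero]

theorem ι_eq_sum_stdGen (x : Fin p ⊕ Fin q → ℝ) :
    (ι (stdForm p q) x : StarCl p q) = ∑ i, x i • stdGen p q i := by
  conv_lhs => rw [pi_eq_sum_univ' x]
  exact (map_sum (ι (stdForm p q)) _ _).trans
    (Finset.sum_congr rfl fun i _ => (ι (stdForm p q)).map_smul _ _)

theorem adjoin_range_stdGen (p q : ℕ) : Algebra.adjoin ℝ (Set.range (stdGen p q)) = ⊤ := by
  refine top_unique fun a _ => ?_
  induction a using CliffordAlgebra.induction with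
  | algebraMap r => exact Subalgebra.algebraMap_mem _ r
  | ι x =>
    rw [ι_eq_sum_stdGen]
    exact sum_mem fun i _ => Subalgebra.smul_mem _ (Algebra.subset_adjoin (Set.mem_range_self i)) _
  | mul a b ha hb => exact mul_mem (ha trivial) (hb trivial)
  | add a b ha hb => exact add_mem (ha trivial) (hb trivial)

theorem stdGen_induction {P : StarCl p q → Prop} (algebraMap : ∀ r : ℝ, P (algebraMap ℝ _ r))
    (gen : ∀ i, P (stdGen p q i)) (add : ∀ a b, P a → P b → P (a + b))
    (mul : ∀ a b, P a → P b → P (a * b)) (a : StarCl p q) : P a := by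
  have ha : a ∈ Algebra.adjoin ℝ (Set.range (stdGen p q)) := by simp [adjoin_range_stdGen]
  induction ha using Algebra.adjoin_induction with
  | mem _ hx => obtain ⟨i, rfl⟩ := hx; exact gen i
  | algebraMap r => exact algebraMap r
  | add a b _ _ ha hb => exact add a b ha hb
  | mul a b _ _ ha hb => exact mul a b ha hb

theorem finrank_starCl (p q : ℕ) : Module.finrank ℝ (StarCl p q) = 2 ^ (p + q) := by
  change Module.finrank ℝ (Cl p q) = _
  let b := (Pi.basisFun ℝ (Fin p ⊕ Fin q)).reindex finSumFinEquiv
  rw [(CliffordAlgebra.equivExterior (stdForm p q)).finrank_eq,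
    Module.finrank_eq_card_basis b.ExteriorAlgebra]
  simp

instance : FiniteDimensional ℝ (StarCl p q) :=
  Module.finite_of_finrank_pos (by rw [finrank_starCl]; positivity)

section UniversalProperty

variable {A : Type*} [Ring A] [StarRing A] [Algebra ℝ A] {z : Fin p ⊕ Fin q → A}

theorem IsFrame.linearCombination_mul_self (h : IsFrame (stdSign p q) z) (x : Fin p ⊕ Fin q → ℝ) :
    Fintype.linearCombination ℝ z x * Fintype.linearCombination ℝ z x =
      algebraMap ℝ A (stdForm p q x) := by
  have two : IsUnit (2 : A) := by
    rw [← map_ofNat (algebraMap ℝ A)]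
    exact (IsUnit.mk0 (2 : ℝ) two_ne_zero).map (algebraMap ℝ A)
  revert x
  rw [CliffordAlgebra.forall_mul_self_eq_iff two]
  refine (Pi.basisFun ℝ (Fin p ⊕ Fin q)).ext fun i => (Pi.basisFun ℝ _).ext fun j => ?_
  have lhs : ∀ i, Fintype.linearCombination ℝ z (Pi.single i 1) = z i := fun i => by
    rw [Fintype.linearCombination_apply_single, one_smul]
  rw [Pi.basisFun_apply, Pi.basisFun_apply, LinearMap.compr₂_apply,
    QuadraticMap.polarBilin_apply_apply, Algebra.linearMap_apply]
  change Fintype.linearCombination ℝ z _ * Fintype.linearCombination ℝ z _ +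
    Fintype.linearCombination ℝ z _ * Fintype.linearCombination ℝ z _ = _
  rw [lhs, lhs]
  obtain rfl | hij := eq_or_ne i j
  · rw [QuadraticMap.polar_self, stdForm_single, h.mul_self, Algebra.algebraMap_eq_smul_one,
      ← add_smul, two_smul]
  · rw [polar_stdForm_single hij, h.anticomm i j hij, add_neg_cancel, map_zero]

theorem IsFrame.exists_starAlgHom [StarModule ℝ A] (h : IsFrame (stdSign p q) z) :
    ∃ f : StarCl p q →⋆ₐ[ℝ] A, ∀ i, f (stdGen p q i) = z i := by
  let f : StarCl p q →ₐ[ℝ] A := CliffordAlgebra.lift (stdForm p q)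
    ⟨Fintype.linearCombination ℝ z, h.linearCombination_mul_self⟩
  have f_gen (i) : f (stdGen p q i) = z i := by
    refine (CliffordAlgebra.lift_ι_apply _ _ _).trans ?_
    rw [Fintype.linearCombination_apply_single, one_smul]
  refine ⟨⟨f, fun a => ?_⟩, f_gen⟩
  change f (star a) = star (f a)
  induction a using stdGen_induction with
  | algebraMap r => rw [← algebraMap_star_comm, AlgHom.commutes, AlgHom.commutes,
      algebraMap_star_comm]
  | gen i => rw [(isFrame_stdGen p q).star_eq, map_smul, f_gen, h.star_eq]
  | add a b ha hb => rw [star_add, map_add, map_add, star_add, ha, hb]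
  | mul a b ha hb => rw [star_mul, map_mul, map_mul, star_mul, ha, hb]

theorem IsFrame.exists_starAlgEquiv [StarModule ℝ A] (h : IsFrame (stdSign p q) z)
    (hz : Algebra.adjoin ℝ (Set.range z) = ⊤) (hA : Module.finrank ℝ A = 2 ^ (p + q)) :
    ∃ e : StarCl p q ≃⋆ₐ[ℝ] A, ∀ i, e (stdGen p q i) = z i := by
  obtain ⟨f, hf⟩ := h.exists_starAlgHom
  have : FiniteDimensional ℝ A := Module.finite_of_finrank_pos (by rw [hA]; positivity)
  have surj : Function.Surjective f := by
    have : f.toAlgHom.range = ⊤ := by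
      refine top_unique (hz ▸ Algebra.adjoin_le (Set.range_subset_iff.2 fun i => ?_))
      exact ⟨stdGen p q i, hf i⟩
    exact AlgHom.range_eq_top _ |>.1 this
  have inj : Function.Injective f :=
    (LinearMap.injective_iff_surjective_of_finrank_eq_finrank (f := f.toAlgHom.toLinearMap)
      ((finrank_starCl p q).trans hA.symm)).2 surj
  exact ⟨StarAlgEquiv.ofBijective f ⟨inj, surj⟩, hf⟩

end UniversalProperty

end StarClifford

section Signatures

theorem adjoin_eq_top_of_stdGen_mem {p q : ℕ} {S : Set (StarCl p q)}
    (h : ∀ i, stdGen p q i ∈ Algebra.adjoin ℝ S) : Algebra.adjoin ℝ S = ⊤ :=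
  top_unique (adjoin_range_stdGen p q ▸ Algebra.adjoin_le (Set.range_subset_iff.2 h))

theorem nonempty_starAlgEquiv_swap (p q : ℕ) :
    Nonempty (StarCl (q + 1) p ≃⋆ₐ[ℝ] StarCl (p + 1) q) := by
  let z := stdGen (p + 1) q
  have hz : IsFrame (stdSign (p + 1) q) z := isFrame_stdGen _ _
  let g := z (.inl 0)
  have hg : g * g = 1 := by simpa using hz.mul_self (.inl 0)
  let f : Fin (q + 1) ⊕ Fin p → Fin (p + 1) ⊕ Fin q :=
    Sum.elim (Fin.cons (.inl 0) .inr) (.inl ∘ Fin.succ)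
  have hf : Function.Injective f := by
    rintro (i | i) (j | j) <;> try refine Fin.cases ?_ (fun i => ?_) i
    all_goals try refine Fin.cases ?_ (fun j => ?_) j
    all_goals simp [f, Fin.succ_ne_zero, (Fin.succ_ne_zero _).symm]
  let y i := if f i ≠ .inl 0 then z (f i) * g else z (f i)
  have hy : IsFrame (stdSign (q + 1) p) y := by
    refine ((hz.twist (· ≠ .inl 0) (g := g) (γ := 1) (δ := -1) (one_mul 1) (by norm_num)
      (by rw [hg, one_smul]) (by simpa using hz.star_eq (.inl 0))
      (fun i hi => by simpa using hz.anticomm i (.inl 0) hi)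
      (fun i hi => by rw [not_not.1 hi])).comp hf).congr ?_
    rintro (i | i)
    · refine Fin.cases ?_ (fun i => ?_) i <;> simp [f]
    · simp [f, Fin.succ_ne_zero]
  have gen : Algebra.adjoin ℝ (Set.range y) = ⊤ := by
    have mem (i) : y i ∈ Algebra.adjoin ℝ (Set.range y) :=
      Algebra.subset_adjoin (Set.mem_range_self i)
    have g_mem : g ∈ Algebra.adjoin ℝ (Set.range y) := by simpa [y, f] using mem (.inl 0)
    have z_mem (i) (hi : f i ≠ .inl 0) : z (f i) ∈ Algebra.adjoin ℝ (Set.range y) := by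
      simpa only [y, if_pos hi, mul_assoc, hg, mul_one] using mul_mem (mem i) g_mem
    refine adjoin_eq_top_of_stdGen_mem ?_
    rintro (i | i)
    · refine Fin.cases g_mem (fun i => z_mem (.inr i) ?_) i
      simp [f, Fin.succ_ne_zero]
    · exact z_mem (.inl i.succ) (by simp [f])
  obtain ⟨e, -⟩ := hy.exists_starAlgEquiv gen
    (by rw [finrank_starCl, add_right_comm, add_comm p q, add_right_comm])
  exact ⟨e⟩

/-- The product of the first four members of a frame, by which they are multiplied in order to
change the signature `(0, 4 + q)` into `(4, q)`. -/
def quad {A : Type*} [Ring A] {q : ℕ} (z : Fin 4 ⊕ Fin q → A) : A := (List.ofFn (z ∘ .inl)).prod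

section Quad

variable {A : Type*} [Ring A] [StarRing A] [Algebra ℝ A] {q : ℕ} {z : Fin 4 ⊕ Fin q → A}

theorem prodSign_four : prodSign (-1) 4 = 1 := by norm_num [prodSign, Nat.choose]

theorem IsFrame.quad_mul_self (hz : IsFrame (fun _ => -1) z) : quad z * quad z = 1 := by
  rw [quad, IsFrame.prod_mul_self (c := -1) (hz.comp Sum.inl_injective), prodSign_four, one_smul]

theorem IsFrame.quad_anticomm (hz : IsFrame (fun _ => -1) z) (i : Fin 4) :
    quad z * z (.inl i) = -(z (.inl i) * quad z) := by
  refine (prod_ofFn_mul_self (hz.comp Sum.inl_injective).anticomm i).trans ?_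
  rw [Odd.neg_one_pow (by decide), neg_one_smul]
  rfl

theorem IsFrame.quad_comm (hz : IsFrame (fun _ => -1) z) (i : Fin q) :
    quad z * z (.inr i) = z (.inr i) * quad z := by
  refine (prod_ofFn_mul_anticomm fun j => hz.anticomm _ _ (by simp)).trans ?_
  rw [Even.neg_one_pow (by decide), one_smul]
  rfl

theorem IsFrame.twist_quad [StarModule ℝ A] (hz : IsFrame (fun _ => -1) z) :
    IsFrame (stdSign 4 q) (fun i => if i.isLeft then z i * quad z else z i) := by
  have star_quad : star (quad z) = quad z := by
    rw [quad, IsFrame.star_prod (c := -1) (hz.comp Sum.inl_injective), prodSign_four, one_smul]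
  refine (hz.twist (·.isLeft) (g := quad z) (γ := 1) (δ := -1) (one_mul 1) (by norm_num)
    (by rw [hz.quad_mul_self, one_smul]) (by rw [star_quad, one_smul]) ?_ ?_).congr ?_ <;>
    rintro (i | i)
  · exact fun _ => by rw [hz.quad_anticomm, neg_one_smul]
  · simp
  · simp
  · exact fun _ => hz.quad_comm i
  · simp
  · simp

theorem IsFrame.mem_adjoin_twist_quad (hz : IsFrame (fun _ => -1) z) (i : Fin 4 ⊕ Fin q) :
    z i ∈ Algebra.adjoin ℝ (Set.range fun i => if i.isLeft then z i * quad z else z i) := by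
  set y := fun i => if i.isLeft then z i * quad z else z i
  have mem (i) : y i ∈ Algebra.adjoin ℝ (Set.range y) :=
    Algebra.subset_adjoin (Set.mem_range_self i)
  have pair (i j : Fin 4) : y (.inl i) * y (.inl j) = -(z (.inl i) * z (.inl j)) := by
    change z (.inl i) * quad z * (z (.inl j) * quad z) = _
    rw [← mul_assoc, mul_assoc _ (quad z), hz.quad_anticomm, mul_neg, neg_mul, mul_assoc,
      mul_assoc, hz.quad_mul_self, mul_one]
  have quad_mem : quad z ∈ Algebra.adjoin ℝ (Set.range y) := by
    have : y (.inl 0) * y (.inl 1) * (y (.inl 2) * y (.inl 3)) = quad z := by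
      rw [pair, pair, neg_mul_neg, mul_assoc]
      simp [quad]
    exact this ▸ mul_mem (mul_mem (mem _) (mem _)) (mul_mem (mem _) (mem _))
  rcases i with i | i
  · simpa [y, mul_assoc, hz.quad_mul_self] using mul_mem (mem (.inl i)) quad_mem
  · exact mem (.inr i)

end Quad

theorem nonempty_starAlgEquiv_shift (q : ℕ) :
    Nonempty (StarCl 4 q ≃⋆ₐ[ℝ] StarCl 0 (4 + q)) := by
  have hz : IsFrame (fun _ => -1) (stdGen 0 (4 + q) ∘ .inr ∘ finSumFinEquiv) :=
    (isFrame_stdGen 0 (4 + q)).comp (Sum.inr_injective.comp finSumFinEquiv.injective)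
  have gen := adjoin_eq_top_of_stdGen_mem (p := 0) (q := 4 + q) (Sum.rec (fun i => i.elim0)
    fun i => by simpa using hz.mem_adjoin_twist_quad (finSumFinEquiv.symm i))
  obtain ⟨e, -⟩ := hz.twist_quad.exists_starAlgEquiv gen (by rw [finrank_starCl, zero_add])
  exact ⟨e⟩

end Signatures

section Doubling

open Matrix

section Matrices

variable (B : Type*) [Ring B]

/-- The Hermitian matrix `diag(1, -1)`, the image of the generator `v⁺₁`. -/
def signTwo : Matrix (Fin 2) (Fin 2) B := !![1, 0; 0, -1]

/-- The skew-Hermitian matrix of square `-1`, the image of the generator `v⁻₁`. -/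
def skewTwo : Matrix (Fin 2) (Fin 2) B := !![0, -1; 1, 0]

variable {B} [Algebra ℝ B] {S : Subalgebra ℝ (Matrix (Fin 2) (Fin 2) B)}

theorem eq_top_of_signTwo_mem (hS : signTwo B ∈ S) (hK : skewTwo B ∈ S)
    (hdiag : ∀ b : B, !![b, 0; 0, b] ∈ S) : S = ⊤ := by
  refine top_unique fun M _ => ?_
  have expand : M = (1 / 2 : ℝ) •
      (!![M 0 0, 0; 0, M 0 0] * (1 + signTwo B) + !![M 1 1, 0; 0, M 1 1] * (1 - signTwo B) -
        !![M 0 1, 0; 0, M 0 1] * (skewTwo B + signTwo B * skewTwo B) +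
        !![M 1 0, 0; 0, M 1 0] * (skewTwo B - signTwo B * skewTwo B)) := by
    have half (b : B) : (1 / 2 : ℝ) • (b + b) = b := by rw [← two_smul ℝ, smul_smul]; norm_num
    ext i j
    fin_cases i <;> fin_cases j <;>
      simp [signTwo, skewTwo, Matrix.one_fin_two, mul_add, half, -smul_add, -one_div]
  rw [expand]
  have hSK := mul_mem hS hK
  exact S.smul_mem (add_mem (sub_mem (add_mem (mul_mem (hdiag _) (add_mem (one_mem _) hS))
    (mul_mem (hdiag _) (sub_mem (one_mem _) hS))) (mul_mem (hdiag _) (add_mem hK hSK)))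
    (mul_mem (hdiag _) (sub_mem hK hSK))) _

end Matrices

variable {p q : ℕ}

/-- The images of the generators of `C(p+1,q+1)` in the `2 × 2` matrices over `C(p,q)`. -/
def doublingFrame (p q : ℕ) :
    Fin (p + 1) ⊕ Fin (q + 1) → Matrix (Fin 2) (Fin 2) (StarCl p q) :=
  consPair (signTwo _) (skewTwo _) fun i => !![0, stdGen p q i; stdGen p q i, 0]

theorem isFrame_doublingFrame (p q : ℕ) :
    IsFrame (stdSign (p + 1) (q + 1)) (doublingFrame p q) := by
  have hy := isFrame_stdGen p q
  have off_diagonal : IsFrame (stdSign p q)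
      (fun i => (!![0, stdGen p q i; stdGen p q i, 0] : Matrix (Fin 2) (Fin 2) (StarCl p q))) := by
    refine ⟨hy.sign_mul_self, fun i => ?_, fun i => ?_, fun i j hij => ?_⟩
    · simp [hy.mul_self, Matrix.one_fin_two]
    · ext k l; fin_cases k <;> fin_cases l <;> simp [hy.star_eq]
    · simp [hy.anticomm i j hij]
  refine isFrame_consPair off_diagonal ?_ ?_ ?_ ?_ ?_ (fun i => ?_) (fun i => ?_) <;>
    ext k l <;> fin_cases k <;> fin_cases l <;> simp [signTwo, skewTwo]

theorem adjoin_range_doublingFrame (p q : ℕ) :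
    Algebra.adjoin ℝ (Set.range (doublingFrame p q)) = ⊤ := by
  set S := Algebra.adjoin ℝ (Set.range (doublingFrame p q))
  have mem (i) : doublingFrame p q i ∈ S := Algebra.subset_adjoin (Set.mem_range_self i)
  have hS : signTwo (StarCl p q) ∈ S := mem (.inl 0)
  have hK : skewTwo (StarCl p q) ∈ S := mem (.inr 0)
  refine eq_top_of_signTwo_mem hS hK fun b => ?_
  induction b using stdGen_induction with
  | algebraMap r =>
    convert S.algebraMap_mem r
    ext k l
    fin_cases k <;> fin_cases l <;> simp [Matrix.algebraMap_matrix_apply]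
  | gen i =>
    have gen_mem : !![0, stdGen p q i; stdGen p q i, 0] ∈ S := by
      rcases i with i | i
      · exact mem (.inl i.succ)
      · exact mem (.inr i.succ)
    convert neg_mem (mul_mem gen_mem (mul_mem hS hK)) using 1
    simp [signTwo, skewTwo]
  | add a b ha hb => simpa using add_mem ha hb
  | mul a b ha hb => simpa using mul_mem ha hb

theorem exists_doubling (p q : ℕ) :
    ∃ e : StarCl (p + 1) (q + 1) ≃⋆ₐ[ℝ] Matrix (Fin 2) (Fin 2) (StarCl p q),
      e (stdGen _ _ (.inl 0)) = signTwo _ ∧ e (stdGen _ _ (.inr 0)) = skewTwo _ := by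
  obtain ⟨e, he⟩ := (isFrame_doublingFrame p q).exists_starAlgEquiv (adjoin_range_doublingFrame p q)
    (by rw [Module.finrank_matrix, finrank_starCl]; simp only [Fintype.card_fin]; ring)
  exact ⟨e, he _, he _⟩

end Doubling

section VolumeElements

variable {p q : ℕ}

/-- The formal properties of `J₊` and `J₋` in `C(p+1,q+1)` by which `J` can serve as the image of
`v⁺₁` or `v⁻₁` under an automorphism: `J² = ε`, `J* = εJ`, and `J` commutes with `v⁺ᵢ` up to the
sign `c` and with `v⁻ⱼ` up to the sign `-c`. By the last property, `v⁺₁` or `v⁻₁` can be recovered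
from `J` and the remaining generators. -/
structure IsVolumeElement (ε c : ℝ) (J : StarCl (p + 1) (q + 1)) : Prop where
  eq_or : ε = 1 ∨ ε = -1
  comm_mul_self : c * c = 1
  mul_self : J * J = ε • 1
  star_eq : star J = ε • J
  mul_gen : ∀ i, J * stdGen _ _ i = (c * stdSign _ _ i) • (stdGen _ _ i * J)
  gen_mem : ∀ S : Subalgebra ℝ (StarCl (p + 1) (q + 1)), J ∈ S →
    (∀ i : Fin p ⊕ Fin q, stdGen _ _ (i.map Fin.succ Fin.succ) ∈ S) →
    stdGen _ _ (.inl 0) ∈ S ∨ stdGen _ _ (.inr 0) ∈ S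

/-- The product `v⁺₁v⁻₁`, a self-adjoint element of square `1` commuting with the remaining
generators. -/
def firstPair (p q : ℕ) : StarCl (p + 1) (q + 1) := stdGen _ _ (.inl 0) * stdGen _ _ (.inr 0)

theorem stdGen_inl_mul_self (i : Fin p) : stdGen p q (.inl i) * stdGen p q (.inl i) = 1 := by
  simpa using (isFrame_stdGen p q).mul_self (.inl i)

theorem stdGen_inr_mul_self (j : Fin q) : stdGen p q (.inr j) * stdGen p q (.inr j) = -1 := by
  simpa using (isFrame_stdGen p q).mul_self (.inr j)

theorem stdGen_anticomm {i j : Fin p ⊕ Fin q} (h : i ≠ j) :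
    stdGen p q j * stdGen p q i = -(stdGen p q i * stdGen p q j) :=
  (isFrame_stdGen p q).anticomm i j h

theorem firstPair_mul_self : firstPair p q * firstPair p q = 1 := by
  rw [firstPair, mul_assoc, ← mul_assoc (stdGen _ _ (.inr 0)), stdGen_anticomm Sum.inl_ne_inr,
    neg_mul, mul_neg, mul_assoc, stdGen_inr_mul_self, mul_neg_one, mul_neg, neg_neg,
    stdGen_inl_mul_self]

theorem star_firstPair : star (firstPair p q) = firstPair p q := by
  rw [firstPair, star_mul, (isFrame_stdGen _ _).star_eq, (isFrame_stdGen _ _).star_eq]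
  simp [stdGen_anticomm Sum.inl_ne_inr]

theorem firstPair_mul_gen (i : Fin p ⊕ Fin q) :
    firstPair p q * stdGen _ _ (i.map Fin.succ Fin.succ) =
      stdGen _ _ (i.map Fin.succ Fin.succ) * firstPair p q := by
  have ha : i.map Fin.succ Fin.succ ≠ .inl 0 := by rcases i with i | i <;> simp [Fin.succ_ne_zero]
  have hb : i.map Fin.succ Fin.succ ≠ .inr 0 := by rcases i with i | i <;> simp [Fin.succ_ne_zero]
  rw [firstPair, mul_assoc, stdGen_anticomm hb, mul_neg, ← mul_assoc, stdGen_anticomm ha, neg_mul,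
    neg_neg, mul_assoc]

namespace IsVolumeElement

variable {ε c : ℝ} {J : StarCl (p + 1) (q + 1)}

theorem firstPair_mul (h : IsVolumeElement ε c J) :
    J * firstPair p q = -(firstPair p q * J) := by
  rw [firstPair, ← mul_assoc, h.mul_gen, smul_mul_assoc, mul_assoc, h.mul_gen, mul_smul_comm,
    smul_smul]
  simp [h.comm_mul_self, mul_assoc]

/-- The generators `v⁺₂, …, v⁻₂, …`, corrected by the factor `v⁺₁v⁻₁` where they commute with
`J`. -/
def rest (c : ℝ) (p q : ℕ) (i : Fin p ⊕ Fin q) : StarCl (p + 1) (q + 1) :=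
  if c * stdSign p q i = 1 then stdGen _ _ (i.map Fin.succ Fin.succ) * firstPair p q
  else stdGen _ _ (i.map Fin.succ Fin.succ)

theorem isFrame_rest : IsFrame (stdSign p q) (rest c p q) := by
  have inj : Function.Injective (Sum.map Fin.succ Fin.succ : Fin p ⊕ Fin q → _) :=
    (Fin.succ_injective _).sumMap (Fin.succ_injective _)
  refine (((isFrame_stdGen (p + 1) (q + 1)).comp inj).twist (fun i => c * stdSign p q i = 1)
    (one_mul 1) (one_mul 1) (g := firstPair p q) ?_ ?_ ?_ ?_).congr ?_
  · rw [firstPair_mul_self, one_smul]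
  · rw [star_firstPair, one_smul]
  · exact fun i _ => by rw [one_smul]; exact firstPair_mul_gen i
  · exact fun i _ => firstPair_mul_gen i
  · rintro (i | i) <;> simp

theorem rest_mul (h : IsVolumeElement ε c J) (i : Fin p ⊕ Fin q) :
    rest c p q i * J = -(J * rest c p q i) := by
  have comm : J * stdGen _ _ (i.map Fin.succ Fin.succ) =
      (c * stdSign p q i) • (stdGen _ _ (i.map Fin.succ Fin.succ) * J) := by
    rw [h.mul_gen]
    rcases i with i | i <;> rfl
  have sign : c * stdSign p q i = 1 ∨ c * stdSign p q i = -1 := by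
    refine mul_self_eq_one_iff.1 ?_
    rw [mul_mul_mul_comm, h.comm_mul_self, (isFrame_stdGen p q).sign_mul_self, one_mul]
  rcases sign with hi | hi
  · rw [rest, if_pos hi, ← mul_assoc, comm, hi, one_smul, mul_assoc, mul_assoc,
      h.firstPair_mul, mul_neg, neg_neg]
  · rw [rest, if_neg (by rw [hi]; norm_num), comm, hi, neg_one_smul, neg_neg]

theorem adjoin_eq_top (h : IsVolumeElement ε c J)
    {S : Set (StarCl (p + 1) (q + 1))} (hJ : J ∈ Algebra.adjoin ℝ S)
    (hJw : J * firstPair p q ∈ Algebra.adjoin ℝ S)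
    (hrest : ∀ i, rest c p q i ∈ Algebra.adjoin ℝ S) : Algebra.adjoin ℝ S = ⊤ := by
  have hw : firstPair p q ∈ Algebra.adjoin ℝ S := by
    have eq : firstPair p q = ε • (J * (J * firstPair p q)) := by
      rw [← mul_assoc, h.mul_self, smul_mul_assoc, one_mul, smul_smul,
        mul_self_eq_one_iff.2 h.eq_or, one_smul]
    exact eq ▸ Subalgebra.smul_mem _ (mul_mem hJ hJw) _
  have tail_mem (i : Fin p ⊕ Fin q) :
      stdGen _ _ (i.map Fin.succ Fin.succ) ∈ Algebra.adjoin ℝ S := by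
    have hi := hrest i
    rw [rest] at hi
    split_ifs at hi
    · simpa only [mul_assoc, firstPair_mul_self, mul_one] using mul_mem hi hw
    · exact hi
  have head_mem : stdGen _ _ (.inl 0) ∈ Algebra.adjoin ℝ S ∧
      stdGen _ _ (.inr 0) ∈ Algebra.adjoin ℝ S := by
    rcases h.gen_mem _ hJ tail_mem with ha | hb
    · refine ⟨ha, ?_⟩
      simpa only [firstPair, ← mul_assoc, stdGen_inl_mul_self, one_mul] using mul_mem ha hw
    · refine ⟨?_, hb⟩
      simpa only [firstPair, mul_assoc, stdGen_inr_mul_self, mul_neg_one, neg_neg] using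
        neg_mem (mul_mem hw hb)
  refine adjoin_eq_top_of_stdGen_mem ?_
  rintro (i | i)
  · exact Fin.cases head_mem.1 (fun i => tail_mem (.inl i)) i
  · exact Fin.cases head_mem.2 (fun i => tail_mem (.inr i)) i

theorem mul_firstPair_mul_self (h : IsVolumeElement ε c J) :
    J * firstPair p q * (J * firstPair p q) = -ε • 1 := by
  rw [← mul_assoc, mul_assoc J, ← neg_eq_iff_eq_neg.2 (h.firstPair_mul)]
  simp only [mul_neg, neg_mul, ← mul_assoc, h.mul_self]
  rw [mul_assoc, firstPair_mul_self, mul_one, neg_smul]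

theorem star_mul_firstPair (h : IsVolumeElement ε c J) :
    star (J * firstPair p q) = -ε • (J * firstPair p q) := by
  rw [star_mul, star_firstPair, h.star_eq, mul_smul_comm, h.firstPair_mul, neg_smul, smul_neg,
    neg_neg]

theorem rest_mul_firstPair (h : IsVolumeElement ε c J) (i : Fin p ⊕ Fin q) :
    rest c p q i * (J * firstPair p q) = -(J * firstPair p q * rest c p q i) := by
  have comm : firstPair p q * rest c p q i = rest c p q i * firstPair p q := by
    rw [rest]
    split_ifs
    · rw [← mul_assoc, firstPair_mul_gen]
    · exact firstPair_mul_gen i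
  rw [← mul_assoc, h.rest_mul, neg_mul, mul_assoc, ← comm, mul_assoc]

theorem mul_firstPair_mul (h : IsVolumeElement ε c J) :
    J * firstPair p q * J = -(J * (J * firstPair p q)) := by
  rw [mul_assoc, ← mul_neg, h.firstPair_mul, neg_neg]

theorem exists_automorphism_inl (h : IsVolumeElement 1 c J) :
    ∃ e : StarCl (p + 1) (q + 1) ≃⋆ₐ[ℝ] StarCl (p + 1) (q + 1), e (stdGen _ _ (.inl 0)) = J := by
  have hz := isFrame_consPair (a := J) (b := J * firstPair p q) (isFrame_rest (c := c))
    (by rw [h.mul_self, one_smul]) (by rw [h.mul_firstPair_mul_self, neg_one_smul])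
    (by rw [h.star_eq, one_smul]) (by rw [h.star_mul_firstPair, neg_one_smul])
    (h.mul_firstPair_mul) (h.rest_mul) (h.rest_mul_firstPair)
  have mem (i) := Algebra.subset_adjoin (R := ℝ) (Set.mem_range_self (f := consPair J
    (J * firstPair p q) (rest c p q)) i)
  have gen := h.adjoin_eq_top (mem (.inl 0)) (mem (.inr 0))
    (Sum.rec (fun i => mem (.inl i.succ)) fun i => mem (.inr i.succ))
  obtain ⟨e, he⟩ := hz.exists_starAlgEquiv gen (finrank_starCl _ _)
  exact ⟨e, he _⟩

theorem exists_automorphism_inr (h : IsVolumeElement (-1) c J) :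
    ∃ e : StarCl (p + 1) (q + 1) ≃⋆ₐ[ℝ] StarCl (p + 1) (q + 1), e (stdGen _ _ (.inr 0)) = J := by
  have hz := isFrame_consPair (a := J * firstPair p q) (b := J) (isFrame_rest (c := c))
    (by rw [h.mul_firstPair_mul_self, neg_neg, one_smul]) (by rw [h.mul_self, neg_one_smul])
    (by rw [h.star_mul_firstPair, neg_neg, one_smul]) (by rw [h.star_eq, neg_one_smul])
    (by rw [h.mul_firstPair_mul, neg_neg]) (h.rest_mul_firstPair) (h.rest_mul)
  have mem (i) := Algebra.subset_adjoin (R := ℝ) (Set.mem_range_self (f := consPair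
    (J * firstPair p q) J (rest c p q)) i)
  have gen := h.adjoin_eq_top (mem (.inr 0)) (mem (.inl 0))
    (Sum.rec (fun i => mem (.inl i.succ)) fun i => mem (.inr i.succ))
  obtain ⟨e, he⟩ := hz.exists_starAlgEquiv gen (finrank_starCl _ _)
  exact ⟨e, he _⟩

theorem exists_doubling (h : IsVolumeElement ε c J) :
    ∃ e : StarCl (p + 1) (q + 1) ≃⋆ₐ[ℝ] Matrix (Fin 2) (Fin 2) (StarCl p q),
      (ε = 1 → e J = signTwo _) ∧ (ε = -1 → e J = skewTwo _) := by
  obtain ⟨e, he, he'⟩ := IndefClifford.exists_doubling p q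
  obtain rfl | rfl := h.eq_or
  · obtain ⟨f, hf⟩ := h.exists_automorphism_inl
    refine ⟨f.symm.trans e, fun _ => ?_, fun h => by norm_num at h⟩
    rw [StarAlgEquiv.trans_apply, ← hf, StarAlgEquiv.symm_apply_apply, he]
  · obtain ⟨f, hf⟩ := h.exists_automorphism_inr
    refine ⟨f.symm.trans e, fun h => by norm_num at h, fun _ => ?_⟩
    rw [StarAlgEquiv.trans_apply, ← hf, StarAlgEquiv.symm_apply_apply, he']

end IsVolumeElement

theorem IsFrame.head_mem {A : Type*} [Ring A] [StarRing A] [Algebra ℝ A] {n : ℕ} {c : ℝ}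
    {y : Fin (n + 1) → A} (h : IsFrame (fun _ => c) y) {S : Subalgebra ℝ A}
    (prod_mem : (List.ofFn y).prod ∈ S) (tail_mem : ∀ i : Fin n, y i.succ ∈ S) : y 0 ∈ S := by
  have htail := h.comp (Fin.succ_injective n)
  have hc : prodSign c n * prodSign c n = 1 := by
    rw [prodSign, mul_mul_mul_comm, ← mul_pow, ← mul_pow, h.sign_mul_self 0]
    norm_num
  have eq : y 0 = prodSign c n • ((List.ofFn y).prod * (List.ofFn (y ∘ Fin.succ)).prod) := by
    rw [List.ofFn_succ, List.prod_cons, mul_assoc]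
    change _ = _ • (y 0 * ((List.ofFn (y ∘ Fin.succ)).prod * (List.ofFn (y ∘ Fin.succ)).prod))
    rw [htail.prod_mul_self, mul_smul_comm, mul_one, smul_smul, hc, one_smul]
  rw [eq]
  refine S.smul_mem (mul_mem prod_mem (list_prod_mem fun x hx => ?_)) _
  obtain ⟨i, rfl⟩ := List.mem_ofFn.1 hx
  exact tail_mem i

theorem isFrame_stdGen_inl (p q : ℕ) : IsFrame (fun _ => 1) (stdGen p q ∘ .inl) :=
  (isFrame_stdGen p q).comp Sum.inl_injective

theorem isFrame_stdGen_inr (p q : ℕ) : IsFrame (fun _ => -1) (stdGen p q ∘ .inr) :=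
  (isFrame_stdGen p q).comp Sum.inr_injective

/-- `J₊` in `C(p,q)` with the involution `a ↦ a*`. -/
def volPlus (p q : ℕ) : StarCl p q := (List.ofFn (stdGen p q ∘ .inl)).prod

/-- `J₋` in `C(p,q)` with the involution `a ↦ a*`. -/
def volMinus (p q : ℕ) : StarCl p q := (List.ofFn (stdGen p q ∘ .inr)).prod

theorem volPlus_mul_gen (p q : ℕ) (i : Fin p ⊕ Fin q) :
    volPlus p q * stdGen p q i =
      ((-1) ^ (p + 1) * stdSign p q i) • (stdGen p q i * volPlus p q) := by
  rcases i with i | j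
  · obtain _ | p := p
    · exact i.elim0
    · rw [stdSign, Sum.elim_inl, mul_one, pow_succ, pow_succ, mul_assoc, neg_one_mul, neg_neg,
        mul_one]
      exact prod_ofFn_mul_self (isFrame_stdGen_inl _ _).anticomm i
  · rw [stdSign, Sum.elim_inr, pow_succ, mul_assoc, neg_one_mul, neg_neg, mul_one]
    exact prod_ofFn_mul_anticomm fun j => stdGen_anticomm (by simp)

theorem volMinus_mul_gen (p q : ℕ) (i : Fin p ⊕ Fin q) :
    volMinus p q * stdGen p q i = ((-1) ^ q * stdSign p q i) • (stdGen p q i * volMinus p q) := by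
  rcases i with i | j
  · rw [stdSign, Sum.elim_inl, mul_one]
    exact prod_ofFn_mul_anticomm fun j => stdGen_anticomm (by simp)
  · obtain _ | q := q
    · exact j.elim0
    · rw [stdSign, Sum.elim_inr, pow_succ, mul_assoc, neg_one_mul, neg_neg, mul_one]
      exact prod_ofFn_mul_self (isFrame_stdGen_inr _ _).anticomm j

theorem isVolumeElement_volPlus (p q : ℕ) :
    IsVolumeElement (prodSign 1 (p + 1)) ((-1) ^ p) (volPlus (p + 1) (q + 1)) where
  eq_or := prodSign_one_eq_or _
  comm_mul_self := by rw [← mul_pow]; norm_num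
  mul_self := (isFrame_stdGen_inl _ _).prod_mul_self
  star_eq := (isFrame_stdGen_inl _ _).star_prod
  mul_gen i := by simpa only [pow_succ, mul_neg_one, neg_neg] using volPlus_mul_gen _ _ i
  gen_mem _ hJ tail := .inl ((isFrame_stdGen_inl _ _).head_mem hJ fun i => tail (.inl i))

theorem isVolumeElement_volMinus (p q : ℕ) :
    IsVolumeElement (prodSign (-1) (q + 1)) ((-1) ^ (q + 1)) (volMinus (p + 1) (q + 1)) where
  eq_or := by
    rw [prodSign_neg_one_eq_prodSign_one]
    exact prodSign_one_eq_or _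
  comm_mul_self := by rw [← mul_pow]; norm_num
  mul_self := (isFrame_stdGen_inr _ _).prod_mul_self
  star_eq := (isFrame_stdGen_inr _ _).star_prod
  mul_gen := volMinus_mul_gen _ _
  gen_mem _ hJ tail := .inr ((isFrame_stdGen_inr _ _).head_mem hJ fun i => tail (.inr i))

end VolumeElements

section SmallAlgebras

instance : StarModule ℝ ℍ[ℝ] := ⟨fun r a => by ext <;> simp⟩

theorem IsFrame.nonempty_starAlgEquiv_of_neg {A : Type*} [Ring A] [StarRing A] [Algebra ℝ A]
    [StarModule ℝ A] {q : ℕ} {y : Fin q → A} (h : IsFrame (fun _ => -1) y)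
    (hgen : Algebra.adjoin ℝ (Set.range y) = ⊤) (hA : Module.finrank ℝ A = 2 ^ q) :
    Nonempty (StarCl 0 q ≃⋆ₐ[ℝ] A) := by
  let e := Equiv.emptySum (Fin 0) (Fin q)
  have hz : IsFrame (stdSign 0 q) (y ∘ e) :=
    (h.comp e.injective).congr (Sum.rec (fun i => i.elim0) fun _ => rfl)
  have gen : Algebra.adjoin ℝ (Set.range (y ∘ e)) = ⊤ := by rw [e.surjective.range_comp, hgen]
  obtain ⟨f, -⟩ := hz.exists_starAlgEquiv gen (by rw [hA, zero_add])
  exact ⟨f⟩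

theorem nonempty_starAlgEquiv_real : Nonempty (StarCl 0 0 ≃⋆ₐ[ℝ] ℝ) :=
  IsFrame.nonempty_starAlgEquiv_of_neg (y := Fin.elim0)
    ⟨fun i => i.elim0, fun i => i.elim0, fun i => i.elim0, fun i => i.elim0⟩
    (Subsingleton.elim _ _) (by simp)

theorem nonempty_starAlgEquiv_complex : Nonempty (StarCl 0 1 ≃⋆ₐ[ℝ] ℂ) := by
  refine IsFrame.nonempty_starAlgEquiv_of_neg (y := fun _ => Complex.I) ⟨by norm_num, by simp,
    by simp, fun i j hij => absurd (Subsingleton.elim i j) hij⟩ ?_ (by simp)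
  refine top_unique fun a _ => ?_
  have I_mem :=
    Algebra.subset_adjoin (R := ℝ) (Set.mem_range_self (f := fun _ : Fin 1 => Complex.I) 0)
  rw [← Complex.re_add_im a, ← Complex.real_smul]
  exact add_mem (Subalgebra.algebraMap_mem _ _) (Subalgebra.smul_mem _ I_mem _)

theorem nonempty_starAlgEquiv_real_prod : Nonempty (StarCl 1 0 ≃⋆ₐ[ℝ] ℝ × ℝ) := by
  let z : Fin 1 ⊕ Fin 0 → ℝ × ℝ := Sum.elim (fun _ => (1, -1)) Fin.elim0
  have hz : IsFrame (stdSign 1 0) z := by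
    refine ⟨?_, ?_, ?_, ?_⟩
    · rintro (i | i) <;> norm_num
    · rintro (i | i)
      · simp [z]
      · exact i.elim0
    · rintro (i | i)
      · simp [z]
      · exact i.elim0
    · rintro (i | i) (j | j) hij
      · simp [Subsingleton.elim i j] at hij
      all_goals first | exact i.elim0 | exact j.elim0
  have gen : Algebra.adjoin ℝ (Set.range z) = ⊤ := by
    refine top_unique fun a _ => ?_
    have mem := Algebra.subset_adjoin (R := ℝ) (Set.mem_range_self (f := z) (.inl 0))
    have eq : a = ((a.1 + a.2) / 2) • 1 + ((a.1 - a.2) / 2) • z (.inl 0) := by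
      ext <;> simp [z] <;> ring
    exact eq ▸ add_mem (Subalgebra.smul_mem _ (one_mem _) _) (Subalgebra.smul_mem _ mem _)
  obtain ⟨e, -⟩ := hz.exists_starAlgEquiv gen (by simp)
  exact ⟨e⟩

/-- The quaternion units `𝐢, 𝐣, 𝐤`. -/
@[simps]
def quaternionUnit (i : Fin 3) : ℍ[ℝ] where
  re := 0
  imI := if i = 0 then 1 else 0
  imJ := if i = 1 then 1 else 0
  imK := if i = 2 then 1 else 0

theorem isFrame_quaternionUnit : IsFrame (fun _ => -1) quaternionUnit where
  sign_mul_self := by norm_num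
  mul_self i := by fin_cases i <;> ext <;> simp
  star_eq i := by fin_cases i <;> ext <;> simp
  anticomm i j hij := by
    fin_cases i <;> fin_cases j <;> first | exact absurd rfl hij | (ext <;> simp)

theorem eq_sum_quaternionUnit (a : ℍ[ℝ]) :
    a = a.re • 1 + a.imI • quaternionUnit 0 + a.imJ • quaternionUnit 1 +
      a.imK • quaternionUnit 2 := by
  ext <;> simp

theorem nonempty_starAlgEquiv_quaternion : Nonempty (StarCl 0 2 ≃⋆ₐ[ℝ] ℍ[ℝ]) := by
  let y := quaternionUnit ∘ Fin.castSucc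
  refine IsFrame.nonempty_starAlgEquiv_of_neg (y := y)
    (isFrame_quaternionUnit.comp (Fin.castSucc_injective 2)) ?_
    (by simp [Quaternion.finrank_eq_four])
  have mem (i) := Algebra.subset_adjoin (R := ℝ) (Set.mem_range_self (f := y) i)
  have k_mem : quaternionUnit 2 ∈ Algebra.adjoin ℝ (Set.range y) := by
    convert mul_mem (mem 0) (mem 1) using 1
    ext <;> simp [y]
  refine top_unique fun a _ => ?_
  rw [eq_sum_quaternionUnit a]
  exact add_mem (add_mem (add_mem (Subalgebra.smul_mem _ (one_mem _) _)
    (Subalgebra.smul_mem _ (mem 0) _)) (Subalgebra.smul_mem _ (mem 1) _))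
    (Subalgebra.smul_mem _ k_mem _)

theorem nonempty_starAlgEquiv_quaternion_prod : Nonempty (StarCl 0 3 ≃⋆ₐ[ℝ] ℍ[ℝ] × ℍ[ℝ]) := by
  let y (i : Fin 3) : ℍ[ℝ] × ℍ[ℝ] :=
    (quaternionUnit i, (if i = 2 then -1 else 1 : ℝ) • quaternionUnit i)
  have hu := isFrame_quaternionUnit
  have hy : IsFrame (fun _ => -1) y := by
    refine ⟨hu.sign_mul_self, fun i => ?_, fun i => ?_, fun i j hij => ?_⟩ <;>
      refine Prod.ext ?_ ?_
    · exact hu.mul_self i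
    · by_cases hi : i = 2 <;> simp [y, hi, hu.mul_self]
    · exact hu.star_eq i
    · by_cases hi : i = 2 <;> simp [y, hi, hu.star_eq]
    · exact hu.anticomm i j hij
    · change _ • _ * _ • _ = -(_ • _ * _ • _)
      rw [smul_mul_smul_comm, smul_mul_smul_comm, hu.anticomm i j hij, mul_comm, smul_neg]
  refine hy.nonempty_starAlgEquiv_of_neg (top_unique fun a _ => ?_)
    (by simp [Quaternion.finrank_eq_four])
  set S := Algebra.adjoin ℝ (Set.range y)
  have mem (i) : y i ∈ S := Algebra.subset_adjoin (Set.mem_range_self i)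
  have k_mem : (quaternionUnit 2, quaternionUnit 2) ∈ S := by
    convert mul_mem (mem 0) (mem 1) using 1
    ext <;> simp [y]
  have diag_mem (b : ℍ[ℝ]) : (b, b) ∈ S := by
    convert add_mem (add_mem (add_mem (S.smul_mem (one_mem _) b.re) (S.smul_mem (mem 0) b.imI))
      (S.smul_mem (mem 1) b.imJ)) (S.smul_mem k_mem b.imK) using 1
    ext <;> simp [y]
  have sign_mem : ((1, -1) : ℍ[ℝ] × ℍ[ℝ]) ∈ S := by
    convert neg_mem (mul_mem k_mem (mem 2)) using 1
    ext <;> simp [y]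
  have eq : a = (1 / 2 : ℝ) • ((a.1, a.1) * (1 + (1, -1)) + (a.2, a.2) * (1 - (1, -1))) := by
    have half (b : ℍ[ℝ]) : (1 / 2 : ℝ) • (b + b) = b := by rw [← two_smul ℝ, smul_smul]; norm_num
    refine Prod.ext ?_ ?_ <;> simp [mul_add, half, -smul_add, -one_div]
  exact eq ▸ S.smul_mem (add_mem (mul_mem (diag_mem _) (add_mem (one_mem _) sign_mem))
    (mul_mem (diag_mem _) (sub_mem (one_mem _) sign_mem))) _

end SmallAlgebras

section MatrixStar

variable {K L : Type*} [Ring K] [StarRing K] [Algebra ℝ K] [Ring L] [StarRing L] [Algebra ℝ L]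
  {m n : Type*} [Fintype m] [DecidableEq m] [Fintype n] [DecidableEq n]

/-- A star isomorphism of coefficients applied entrywise to matrices. -/
def mapMatrixStarAlgEquiv (m : Type*) [Fintype m] [DecidableEq m] (e : K ≃⋆ₐ[ℝ] L) :
    Matrix m m K ≃⋆ₐ[ℝ] Matrix m m L :=
  StarAlgEquiv.ofAlgEquiv e.toAlgEquiv.mapMatrix fun X => by
    ext i j
    exact map_star e (X j i)

/-- Reindexing of matrices as a star isomorphism. -/
def reindexStarAlgEquiv (K : Type*) [Ring K] [StarRing K] [Algebra ℝ K] (e : m ≃ n) :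
    Matrix m m K ≃⋆ₐ[ℝ] Matrix n n K :=
  StarAlgEquiv.ofAlgEquiv (Matrix.reindexAlgEquiv ℝ K e) fun _ => rfl

/-- Matrices of size one as a star isomorphism. -/
def uniqueStarAlgEquiv (K : Type) [Ring K] [StarRing K] [Algebra ℝ K] : K ≃⋆ₐ[ℝ] Mat 1 K where
  toFun x := Matrix.of fun _ _ => x
  invFun X := X 0 0
  left_inv _ := rfl
  right_inv X := by ext i j; fin_cases i; fin_cases j; rfl
  map_mul' x y := by ext; simp [Matrix.mul_apply]
  map_add' _ _ := rfl
  map_smul' _ _ := rfl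
  map_star' _ := rfl

/-- Matrices of size two with entries in a matrix algebra, as block matrices. -/
def blockStarAlgEquiv (n K : Type*) [Fintype n] [DecidableEq n] [Ring K] [StarRing K]
    [Algebra ℝ K] : Matrix (Fin 2) (Fin 2) (Matrix n n K) ≃⋆ₐ[ℝ] Matrix (n ⊕ n) (n ⊕ n) K where
  toFun X := Matrix.fromBlocks (X 0 0) (X 0 1) (X 1 0) (X 1 1)
  invFun Y := !![Y.toBlocks₁₁, Y.toBlocks₁₂; Y.toBlocks₂₁, Y.toBlocks₂₂]
  left_inv X := by ext i j; fin_cases i <;> fin_cases j <;> rfl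
  right_inv Y := Matrix.fromBlocks_toBlocks Y
  map_mul' X Y := by simp [Matrix.fromBlocks_multiply, Matrix.mul_apply, Fin.sum_univ_two]
  map_add' X Y := by simp [Matrix.fromBlocks_add]
  map_smul' r X := by simp [Matrix.fromBlocks_smul]
  map_star' X := by simp [Matrix.star_eq_conjTranspose, Matrix.fromBlocks_conjTranspose]

theorem blockStarAlgEquiv_apply (X : Matrix (Fin 2) (Fin 2) (Matrix n n K)) :
    blockStarAlgEquiv n K X = Matrix.fromBlocks (X 0 0) (X 0 1) (X 1 0) (X 1 1) := rfl

/-- The skew-Hermitian counterpart of `signMatrix`. -/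
def skewMatrix (n : ℕ) (F : Type*) [Ring F] : Matrix (Fin n ⊕ Fin n) (Fin n ⊕ Fin n) F :=
  Matrix.fromBlocks 0 (-1) 1 0

variable {A B : Type*} [Ring A] [StarRing A] [Algebra ℝ A] [Ring B] [StarRing B] [Algebra ℝ B]

/-- If `A` consists of the matrices of size two over `B`, a matrix representation of `B` gives one
of twice the size of `A`. -/
def doubleStarAlgEquiv {n : ℕ} (e : A ≃⋆ₐ[ℝ] Matrix (Fin 2) (Fin 2) B)
    (f : B ≃⋆ₐ[ℝ] Matrix (Fin n) (Fin n) K) :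
    A ≃⋆ₐ[ℝ] Matrix (Fin n ⊕ Fin n) (Fin n ⊕ Fin n) K :=
  (e.trans (mapMatrixStarAlgEquiv _ f)).trans (blockStarAlgEquiv _ K)

theorem doubleStarAlgEquiv_eq_signMatrix {n : ℕ} {e : A ≃⋆ₐ[ℝ] Matrix (Fin 2) (Fin 2) B} {J : A}
    (h : e J = signTwo B) (f : B ≃⋆ₐ[ℝ] Matrix (Fin n) (Fin n) K) :
    doubleStarAlgEquiv e f J = signMatrix n K := by
  change blockStarAlgEquiv _ K ((e J).map f) = _
  rw [h, blockStarAlgEquiv_apply]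
  simp [signMatrix, signTwo]

theorem doubleStarAlgEquiv_eq_skewMatrix {n : ℕ} {e : A ≃⋆ₐ[ℝ] Matrix (Fin 2) (Fin 2) B} {J : A}
    (h : e J = skewTwo B) (f : B ≃⋆ₐ[ℝ] Matrix (Fin n) (Fin n) K) :
    doubleStarAlgEquiv e f J = skewMatrix n K := by
  change blockStarAlgEquiv _ K ((e J).map f) = _
  rw [h, blockStarAlgEquiv_apply]
  simp [skewMatrix, skewTwo]

end MatrixStar

section Classification

instance : IsModuleTopology ℝ ℂ := isModuleTopologyOfFiniteDimensional

instance : IsModuleTopology ℝ ℍ[ℝ] := isModuleTopologyOfFiniteDimensional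

/-- The shape of the classification of the real Clifford algebras with involution: for a property
`P k K`, the assertion of `P` for the coefficient algebra `K` that belongs to `d = p - q` modulo
`8`. Then `C(p,q)` consists of the matrices of size `2^m` over `K`, where `p + q = 2m + k`. -/
def CliffordTable (P : ℕ → ∀ (K : Type) [Ring K] [StarRing K] [Algebra ℝ K] [TopologicalSpace K]
    [IsModuleTopology ℝ K], Prop) (d : ℤ) : Prop :=
  (d % 8 = 0 ∨ d % 8 = 2 → P 0 ℝ) ∧ (d % 8 = 1 → P 1 (ℝ × ℝ)) ∧ (d % 8 = 3 ∨ d % 8 = 7 → P 1 ℂ) ∧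
  (d % 8 = 4 ∨ d % 8 = 6 → P 2 ℍ[ℝ]) ∧ (d % 8 = 5 → P 3 (ℍ[ℝ] × ℍ[ℝ]))

theorem CliffordTable.mono {P Q : ℕ → ∀ (K : Type) [Ring K] [StarRing K] [Algebra ℝ K]
    [TopologicalSpace K] [IsModuleTopology ℝ K], Prop} {d : ℤ} (h : CliffordTable P d)
    (hPQ : ∀ k (K : Type) [Ring K] [StarRing K] [Algebra ℝ K] [TopologicalSpace K]
      [IsModuleTopology ℝ K], P k K → Q k K) : CliffordTable Q d :=
  ⟨fun hd => hPQ 0 ℝ (h.1 hd), fun hd => hPQ 1 (ℝ × ℝ) (h.2.1 hd),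
    fun hd => hPQ 1 ℂ (h.2.2.1 hd), fun hd => hPQ 2 ℍ[ℝ] (h.2.2.2.1 hd),
    fun hd => hPQ 3 (ℍ[ℝ] × ℍ[ℝ]) (h.2.2.2.2 hd)⟩

variable {A B : Type*} [Ring A] [StarRing A] [Algebra ℝ A] [Ring B] [StarRing B] [Algebra ℝ B]
  {d d' : ℤ} {N : ℕ}

/-- `A` is isomorphic, as an algebra with involution, to the matrix algebra that the classification
prescribes for the Clifford algebras with `p - q = d` and `p + q = N`. -/
def HasCliffordType (d : ℤ) (N : ℕ) (A : Type*) [Ring A] [StarRing A] [Algebra ℝ A] : Prop :=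
  CliffordTable (fun k K _ _ _ _ _ => ∃ m, N = 2 * m + k ∧ Nonempty (A ≃⋆ₐ[ℝ] Mat (2 ^ m) K)) d

theorem HasCliffordType.congr (h : HasCliffordType d N A)
    (hd : d % 8 = d' % 8 ∨ d % 8 = (2 - d') % 8) : HasCliffordType d' N A :=
  ⟨fun _ => h.1 (by omega), fun _ => h.2.1 (by omega), fun _ => h.2.2.1 (by omega),
    fun _ => h.2.2.2.1 (by omega), fun _ => h.2.2.2.2 (by omega)⟩

theorem HasCliffordType.of_starAlgEquiv (h : HasCliffordType d N B) (e : A ≃⋆ₐ[ℝ] B) :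
    HasCliffordType d N A := by
  refine CliffordTable.mono h fun k K _ _ _ _ _ => ?_
  rintro ⟨m, hm, ⟨f⟩⟩
  exact ⟨m, hm, ⟨e.trans f⟩⟩

theorem HasCliffordType.double (h : HasCliffordType d N B)
    (e : A ≃⋆ₐ[ℝ] Matrix (Fin 2) (Fin 2) B) : HasCliffordType d (N + 2) A := by
  refine CliffordTable.mono h fun k K _ _ _ _ _ => ?_
  rintro ⟨m, hm, ⟨f⟩⟩
  have index : Fin (2 ^ m) ⊕ Fin (2 ^ m) ≃ Fin (2 ^ (m + 1)) :=
    finSumFinEquiv.trans (finCongr (by ring))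
  exact ⟨m + 1, by omega, ⟨(doubleStarAlgEquiv e f).trans (reindexStarAlgEquiv K index)⟩⟩

theorem hasCliffordType_doubling {p q : ℕ} (h : HasCliffordType d N (StarCl p q)) :
    HasCliffordType d (N + 2) (StarCl (p + 1) (q + 1)) :=
  let ⟨e, _⟩ := exists_doubling p q
  h.double e

theorem hasCliffordType_starCl (p q : ℕ) :
    HasCliffordType ((p : ℤ) - q) (p + q) (StarCl p q) := by
  have hasSize {A K : Type} [Ring A] [StarRing A] [Algebra ℝ A] [Ring K] [StarRing K] [Algebra ℝ K]
      {k : ℕ} (e : A ≃⋆ₐ[ℝ] K) : ∃ m, k = 2 * m + k ∧ Nonempty (A ≃⋆ₐ[ℝ] Mat (2 ^ m) K) :=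
    ⟨0, by omega, ⟨e.trans (uniqueStarAlgEquiv K)⟩⟩
  match p, q with
  | 0, 0 =>
    obtain ⟨e⟩ := nonempty_starAlgEquiv_real
    exact ⟨fun _ => hasSize e, by omega, by omega, by omega, by omega⟩
  | 1, 0 =>
    obtain ⟨e⟩ := nonempty_starAlgEquiv_real_prod
    exact ⟨by omega, fun _ => hasSize e, by omega, by omega, by omega⟩
  | 0, 1 =>
    obtain ⟨e⟩ := nonempty_starAlgEquiv_complex
    exact ⟨by omega, by omega, fun _ => hasSize e, by omega, by omega⟩
  | 0, 2 =>
    obtain ⟨e⟩ := nonempty_starAlgEquiv_quaternion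
    exact ⟨by omega, by omega, by omega, fun _ => hasSize e, by omega⟩
  | 0, 3 =>
    obtain ⟨e⟩ := nonempty_starAlgEquiv_quaternion_prod
    exact ⟨by omega, by omega, by omega, by omega, fun _ => hasSize e⟩
  | p + 1, q + 1 =>
    convert hasCliffordType_doubling (hasCliffordType_starCl p q) using 1 <;> push_cast <;> ring
  | p + 2, 0 =>
    obtain ⟨e⟩ := nonempty_starAlgEquiv_swap (p + 1) 0
    have h := hasCliffordType_doubling (hasCliffordType_starCl 0 p)
    rw [zero_add] at h
    exact (h.of_starAlgEquiv e.symm).congr (by omega)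
  | 0, q + 4 =>
    obtain ⟨e⟩ := nonempty_starAlgEquiv_shift q
    obtain ⟨f⟩ := nonempty_starAlgEquiv_swap q 3
    have h := hasCliffordType_doubling (hasCliffordType_starCl q 2)
    rw [zero_add, add_comm q 4]
    rw [show q + 2 + 2 = 4 + q by ring] at h
    exact (h.of_starAlgEquiv (e.symm.trans f)).congr (by omega)
termination_by p + q

end Classification

section TopologicalGroups

theorem LieIso.trans {A B C : Type*} [Mul A] [Mul B] [Mul C] [TopologicalSpace A]
    [TopologicalSpace B] [TopologicalSpace C] (h : LieIso A B) (h' : LieIso B C) : LieIso A C :=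
  h.elim fun e => h'.elim fun f => ⟨e.trans f⟩

theorem LieIso.symm {A B : Type*} [Mul A] [Mul B] [TopologicalSpace A] [TopologicalSpace B]
    (h : LieIso A B) : LieIso B A :=
  h.elim fun e => ⟨e.symm⟩

theorem LieIso.prod {A B C D : Type*} [Mul A] [Mul B] [Mul C] [Mul D] [TopologicalSpace A]
    [TopologicalSpace B] [TopologicalSpace C] [TopologicalSpace D] (h : LieIso A B)
    (h' : LieIso C D) : LieIso (A × C) (B × D) :=
  h.elim fun e => h'.elim fun f => ⟨.mk' (e.toHomeomorph.prodCongr f.toHomeomorph) fun x y =>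
    Prod.ext (map_mul e x.1 y.1) (map_mul f x.2 y.2)⟩

theorem lieIso_of_eq {A : Type*} [Monoid A] [TopologicalSpace A] {H K : Submonoid A} (h : H = K) :
    LieIso H K := by
  subst h
  exact ⟨ContinuousMulEquiv.refl _⟩

variable {A B : Type*} [Ring A] [Algebra ℝ A] [TopologicalSpace A] [IsModuleTopology ℝ A]
  [Ring B] [Algebra ℝ B] [TopologicalSpace B] [IsModuleTopology ℝ B]

theorem lieIso_of_algHom {f : A →ₐ[ℝ] B} (hf : Function.Injective f) {H : Submonoid A}
    {K : Submonoid B} (mem_iff : ∀ a, a ∈ H ↔ f a ∈ K) (subset_range : ∀ b ∈ K, b ∈ f.range) :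
    LieIso H K := by
  have := IsModuleTopology.topologicalAddGroup ℝ A
  have := IsModuleTopology.topologicalAddGroup ℝ B
  have := IsModuleTopology.toContinuousSMul ℝ A
  have := IsModuleTopology.toContinuousSMul ℝ B
  obtain ⟨g, hg⟩ := f.toLinearMap.exists_leftInverse_of_injective (LinearMap.ker_eq_bot.2 hf)
  have hgf (a : A) : g (f a) = a := LinearMap.congr_fun hg a
  have hfg (b : K) : f (g b) = b := by
    obtain ⟨a, ha⟩ := subset_range b b.2
    rw [← ha]
    exact congrArg f (hgf a)
  have continuous_f : Continuous f := IsModuleTopology.continuous_of_linearMap f.toLinearMap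
  have continuous_g : Continuous g := IsModuleTopology.continuous_of_linearMap g
  exact ⟨{
    toFun a := ⟨f a, (mem_iff a).1 a.2⟩
    invFun b := ⟨g b, (mem_iff _).2 (by rw [hfg]; exact b.2)⟩
    left_inv a := Subtype.ext (hgf a)
    right_inv b := Subtype.ext (hfg b)
    map_mul' a b := Subtype.ext (map_mul f (a : A) b)
    continuous_toFun := by fun_prop
    continuous_invFun := by fun_prop }⟩

theorem lieIso_of_algEquiv (e : A ≃ₐ[ℝ] B) {H : Submonoid A} {K : Submonoid B}
    (mem_iff : ∀ a, a ∈ H ↔ e a ∈ K) : LieIso H K :=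
  lieIso_of_algHom (f := e.toAlgHom) e.injective mem_iff fun b _ => ⟨e.symm b, e.apply_symm_apply b⟩

end TopologicalGroups

section Isometries

/-- The isometries of the element `J` of a ring with involution: the common generalization of the
groups `AutJ` and `formGroup`. -/
def isomGroup {A : Type*} [Ring A] [StarRing A] (J : A) : Submonoid A where
  carrier := {a | star a * J * a = J}
  one_mem' := by simp
  mul_mem' {a b} (ha : _ = _) (hb : _ = _) := by
    change star (a * b) * J * (a * b) = J
    calc star (a * b) * J * (a * b) = star b * (star a * J * a) * b := by
          rw [star_mul]; noncomm_ring
      _ = J := by rw [ha, hb]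

section Ring

variable {A : Type*} [Ring A] [StarRing A]

theorem mem_isomGroup {J a : A} : a ∈ isomGroup J ↔ star a * J * a = J := Iff.rfl

theorem mem_isomGroup_one {a : A} : a ∈ isomGroup 1 ↔ star a * a = 1 := by
  rw [mem_isomGroup, mul_one]

theorem isomGroup_smul {R : Type*} [Field R] [Algebra R A] {c : R} (hc : c ≠ 0) (J : A) :
    isomGroup (c • J) = isomGroup J := by
  ext a
  rw [mem_isomGroup, mem_isomGroup, mul_smul_comm, smul_mul_assoc,
    (smul_right_injective A hc).eq_iff]

theorem lieIso_isomGroup_prod {B : Type*} [Ring B] [StarRing B] [TopologicalSpace A]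
    [TopologicalSpace B] (J : A) (J' : B) :
    LieIso (isomGroup (J, J')) (isomGroup J × isomGroup J') :=
  ⟨{ toFun a := (⟨a.1.1, congrArg Prod.fst a.2⟩, ⟨a.1.2, congrArg Prod.snd a.2⟩)
     invFun b := ⟨(b.1.1, b.2.1), Prod.ext b.1.2 b.2.2⟩
     left_inv _ := rfl
     right_inv _ := rfl
     map_mul' _ _ := rfl
     continuous_toFun := by fun_prop
     continuous_invFun := by fun_prop }⟩

end Ring

variable {A B : Type*} [Ring A] [StarRing A] [Algebra ℝ A] [TopologicalSpace A]
  [IsModuleTopology ℝ A] [Ring B] [StarRing B] [Algebra ℝ B] [TopologicalSpace B]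
  [IsModuleTopology ℝ B]

theorem lieIso_isomGroup (e : A ≃⋆ₐ[ℝ] B) (J : A) : LieIso (isomGroup J) (isomGroup (e J)) :=
  lieIso_of_algEquiv e.toAlgEquiv fun a => by
    rw [mem_isomGroup, mem_isomGroup, StarAlgEquiv.coe_toAlgEquiv, ← map_star, ← map_mul,
      ← map_mul, (EquivLike.injective e).eq_iff]

theorem lieIso_isomGroup_conj (P : Aˣ) (J : A) :
    LieIso (isomGroup J) (isomGroup (star (P : A) * J * P)) := by
  refine lieIso_of_algEquiv (MulSemiringAction.toAlgEquiv ℝ A (ConjAct.toConjAct P⁻¹)) fun a => ?_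
  have star_inv : star ((P⁻¹ : Aˣ) : A) * star (P : A) = 1 := by rw [← star_mul]; simp
  have conj_apply : MulSemiringAction.toAlgEquiv ℝ A (ConjAct.toConjAct P⁻¹) a = ↑P⁻¹ * a * P := by
    simp [ConjAct.units_smul_def]
  have key : star (↑P⁻¹ * a * P) * (star (P : A) * J * P) * (↑P⁻¹ * a * P) =
      star (P : A) * (star a * J * a) * P := by
    simp only [star_mul, mul_assoc, P.mul_inv_cancel_left]
    rw [← mul_assoc (star ((P⁻¹ : Aˣ) : A)), star_inv, one_mul]
  rw [mem_isomGroup, mem_isomGroup, conj_apply, key, Units.mul_left_inj, ← Units.coe_star,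
    Units.mul_right_inj]

end Isometries

section Forms

variable {F : Type} [Ring F] [StarRing F] [Algebra ℝ F]

instance {m K : Type*} [Finite m] [Ring K] [Algebra ℝ K] [TopologicalSpace K]
    [IsModuleTopology ℝ K] : IsModuleTopology ℝ (Matrix m m K) :=
  inferInstanceAs (IsModuleTopology ℝ (m → m → K))

/-- Matrices of size two, inflated to block matrices with scalar blocks. -/
def inflate (n : ℕ) (F : Type) [Ring F] [StarRing F] [Algebra ℝ F] :
    Matrix (Fin 2) (Fin 2) F →⋆ₐ[ℝ] Matrix (Fin n ⊕ Fin n) (Fin n ⊕ Fin n) F where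
  __ := (blockStarAlgEquiv (Fin n) F).toAlgEquiv.toAlgHom.comp
    (Matrix.scalarAlgHom (Fin n) ℝ).mapMatrix
  map_star' X := by
    change blockStarAlgEquiv _ F ((star X).map (Matrix.scalar (Fin n))) =
      star (blockStarAlgEquiv _ F (X.map (Matrix.scalar (Fin n))))
    rw [← map_star]
    congr 1
    ext1 i j
    exact (Matrix.diagonal_conjTranspose (n := Fin n) fun _ => X j i).symm

theorem inflate_apply (n : ℕ) (X : Matrix (Fin 2) (Fin 2) F) :
    inflate n F X = Matrix.fromBlocks (Matrix.diagonal fun _ => X 0 0)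
      (Matrix.diagonal fun _ => X 0 1) (Matrix.diagonal fun _ => X 1 0)
      (Matrix.diagonal fun _ => X 1 1) := rfl

theorem signMatrix_eq_inflate (n : ℕ) : signMatrix n F = inflate n F (signTwo F) := by
  simp [inflate_apply, signMatrix, signTwo, ← Matrix.diagonal_neg]

theorem skewMatrix_eq_inflate (n : ℕ) : skewMatrix n F = inflate n F (skewTwo F) := by
  simp [inflate_apply, skewMatrix, skewTwo, ← Matrix.diagonal_neg]

theorem lieIso_isomGroup_inflate [TopologicalSpace F] [IsModuleTopology ℝ F] (n : ℕ)
    {J J' : Matrix (Fin 2) (Fin 2) F} (P : (Matrix (Fin 2) (Fin 2) F)ˣ)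
    (hP : star (P : Matrix (Fin 2) (Fin 2) F) * J * P = J') :
    LieIso (isomGroup (inflate n F J)) (isomGroup (inflate n F J')) := by
  have h := lieIso_isomGroup_conj (Units.map (inflate n F : _ →* _) P) (inflate n F J)
  rwa [Units.coe_map, MonoidHom.coe_coe, ← map_star, ← map_mul, ← map_mul, hP] at h

theorem lieIso_spR (n : ℕ) : LieIso (formGroup (skewMatrix n ℝ)) (SpR n) := by
  refine lieIso_of_eq ?_
  ext X
  rw [SymplecticGroup.mem_iff']
  change X.conjTranspose * _ * X = _ ↔ _
  rw [Matrix.conjTranspose_eq_transpose_of_trivial]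
  rfl

theorem lieIso_unn (n : ℕ) : LieIso (formGroup (skewMatrix n ℂ)) (Unn n) := by
  let P : Matrix (Fin 2) (Fin 2) ℂ := !![1, 1; Complex.I, -Complex.I]
  have isUnit_P : IsUnit P := by
    simp [P, Matrix.isUnit_iff_isUnit_det, Matrix.det_fin_two, sub_eq_zero,
      CharZero.neg_eq_self_iff]
  have conj_skew : star P * skewTwo ℂ * P = (-2 * Complex.I) • signTwo ℂ := by
    ext i j
    fin_cases i <;> fin_cases j <;>
      simp [P, skewTwo, signTwo, Matrix.mul_apply, Fin.sum_univ_two] <;> ring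
  have h := lieIso_isomGroup_inflate n isUnit_P.unit conj_skew
  have smul_sign : inflate n ℂ ((-2 * Complex.I) • signTwo ℂ) =
      (-2 * Complex.I) • signMatrix n ℂ := by
    rw [signMatrix_eq_inflate, inflate_apply, inflate_apply, Matrix.fromBlocks_smul]
    simp [← Matrix.diagonal_smul]
  rwa [smul_sign, isomGroup_smul (by simp), ← skewMatrix_eq_inflate] at h

theorem lieIso_formGroup_diagonal_reindex {m m' : Type} [Fintype m] [DecidableEq m] [Fintype m']
    [DecidableEq m'] [TopologicalSpace F] [IsModuleTopology ℝ F] (e : m ≃ m') (x : F) :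
    LieIso (formGroup (Matrix.diagonal fun _ : m => x))
      (formGroup (Matrix.diagonal fun _ : m' => x)) := by
  have h := lieIso_isomGroup (reindexStarAlgEquiv F e) (Matrix.diagonal fun _ => x)
  have reindex_diagonal : reindexStarAlgEquiv F e (Matrix.diagonal fun _ => x) =
      Matrix.diagonal fun _ => x := Matrix.submatrix_diagonal_equiv (fun _ => x) e.symm
  rw [reindex_diagonal] at h
  exact h

/-- The change of basis that diagonalizes the quaternionic skew-Hermitian form `skewTwo`. -/
def quaternionChangeOfBasis : Matrix (Fin 2) (Fin 2) ℍ[ℝ] :=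
  !![1, quaternionUnit 0; -quaternionUnit 1, -(quaternionUnit 0 * quaternionUnit 1)]

theorem star_quaternionChangeOfBasis_mul_skewTwo_mul :
    star quaternionChangeOfBasis * skewTwo ℍ[ℝ] * quaternionChangeOfBasis =
      (2 : ℝ) • Matrix.diagonal fun _ => quaternionUnit 1 := by
  have hi := isFrame_quaternionUnit.mul_self 0
  have star_i := isFrame_quaternionUnit.star_eq 0
  have star_j := isFrame_quaternionUnit.star_eq 1
  have hij := isFrame_quaternionUnit.anticomm 0 1 (by decide)
  rw [quaternionChangeOfBasis]
  generalize quaternionUnit 0 = i at *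
  generalize quaternionUnit 1 = j at *
  rw [neg_one_smul] at hi star_i star_j
  have hi' (x : ℍ[ℝ]) : i * (i * x) = -x := by rw [← mul_assoc, hi, neg_one_mul]
  ext1 a b
  fin_cases a <;> fin_cases b <;>
    simp [skewTwo, Matrix.mul_apply, Fin.sum_univ_two, mul_assoc, star_i, star_j, hij, hi',
      two_smul]

theorem isUnit_quaternionChangeOfBasis : IsUnit quaternionChangeOfBasis := by
  refine IsUnit.of_mul_eq_one
    ((2⁻¹ : ℝ) • !![1, quaternionUnit 1; -quaternionUnit 0, quaternionUnit 0 * quaternionUnit 1]) ?_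
  have hi := isFrame_quaternionUnit.mul_self 0
  have hj := isFrame_quaternionUnit.mul_self 1
  have hij := isFrame_quaternionUnit.anticomm 0 1 (by decide)
  rw [quaternionChangeOfBasis]
  generalize quaternionUnit 0 = i at *
  generalize quaternionUnit 1 = j at *
  rw [neg_one_smul] at hi hj
  have hi' (x : ℍ[ℝ]) : i * (i * x) = -x := by rw [← mul_assoc, hi, neg_one_mul]
  have hij' (x : ℍ[ℝ]) : j * (i * x) = -(i * (j * x)) := by
    rw [← mul_assoc, hij, neg_mul, mul_assoc]
  have half : (2⁻¹ : ℝ) • (1 : ℍ[ℝ]) + (2⁻¹ : ℝ) • (1 : ℍ[ℝ]) = 1 := by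
    rw [← add_smul]; norm_num
  ext1 a b
  fin_cases a <;> fin_cases b <;> simp [mul_assoc, hi, hj, hij, hi', hij', half]

theorem lieIso_oStar (n : ℕ) : LieIso (formGroup (skewMatrix n ℍ[ℝ])) (OStar (2 * n)) := by
  have h := lieIso_isomGroup_inflate n isUnit_quaternionChangeOfBasis.unit
    star_quaternionChangeOfBasis_mul_skewTwo_mul
  rw [map_smul, isomGroup_smul two_ne_zero, ← skewMatrix_eq_inflate,
    show inflate n ℍ[ℝ] (Matrix.diagonal fun _ => quaternionUnit 1) =
      Matrix.diagonal fun _ => quaternionUnit 1 by simp [inflate_apply]] at h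
  exact h.trans (lieIso_formGroup_diagonal_reindex
    (finSumFinEquiv.trans (finCongr (two_mul n).symm)) (quaternionUnit 1))

end Forms

section FormTable

/-- Matrices over a product of rings are pairs of matrices. -/
def matrixProdStarAlgEquiv (m K L : Type*) [Fintype m] [DecidableEq m] [Ring K] [StarRing K]
    [Algebra ℝ K] [Ring L] [StarRing L] [Algebra ℝ L] :
    Matrix m m (K × L) ≃⋆ₐ[ℝ] Matrix m m K × Matrix m m L where
  toFun X := (X.map Prod.fst, X.map Prod.snd)
  invFun Y := Matrix.of fun i j => (Y.1 i j, Y.2 i j)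
  left_inv _ := rfl
  right_inv _ := rfl
  map_mul' _ _ := Prod.ext (Matrix.map_mul (f := RingHom.fst K L))
    (Matrix.map_mul (f := RingHom.snd K L))
  map_add' _ _ := rfl
  map_smul' _ _ := rfl
  map_star' _ := rfl

theorem matrixProdStarAlgEquiv_apply {m K L : Type*} [Fintype m] [DecidableEq m] [Ring K]
    [StarRing K] [Algebra ℝ K] [Ring L] [StarRing L] [Algebra ℝ L] (X : Matrix m m (K × L)) :
    matrixProdStarAlgEquiv m K L X = (X.map Prod.fst, X.map Prod.snd) := rfl

variable {K L : Type} [Ring K] [StarRing K] [Algebra ℝ K] [TopologicalSpace K]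
  [IsModuleTopology ℝ K] [Ring L] [StarRing L] [Algebra ℝ L] [TopologicalSpace L]
  [IsModuleTopology ℝ L]

theorem lieIso_formGroup_signMatrix_prod (n : ℕ) : LieIso (formGroup (signMatrix n (K × L)))
    (formGroup (signMatrix n K) × formGroup (signMatrix n L)) := by
  have h := lieIso_isomGroup (matrixProdStarAlgEquiv _ K L) (signMatrix n (K × L))
  have sign_eq : matrixProdStarAlgEquiv _ K L (signMatrix n (K × L)) =
      (signMatrix n K, signMatrix n L) := by
    rw [matrixProdStarAlgEquiv_apply]
    refine Prod.ext ?_ ?_ <;> ext (i | i) (j | j) <;>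
      simp [signMatrix, Matrix.one_apply, apply_ite Prod.fst,
        apply_ite Prod.snd]
  rw [sign_eq] at h
  exact h.trans (lieIso_isomGroup_prod _ _)

theorem lieIso_formGroup_skewMatrix_prod (n : ℕ) : LieIso (formGroup (skewMatrix n (K × L)))
    (formGroup (skewMatrix n K) × formGroup (skewMatrix n L)) := by
  have h := lieIso_isomGroup (matrixProdStarAlgEquiv _ K L) (skewMatrix n (K × L))
  have skew_eq : matrixProdStarAlgEquiv _ K L (skewMatrix n (K × L)) =
      (skewMatrix n K, skewMatrix n L) := by
    rw [matrixProdStarAlgEquiv_apply]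
    refine Prod.ext ?_ ?_ <;> ext (i | i) (j | j) <;>
      simp [skewMatrix, Matrix.one_apply, apply_ite Prod.fst,
        apply_ite Prod.snd]
  rw [skew_eq] at h
  exact h.trans (lieIso_isomGroup_prod _ _)

/-- The group `H` is the isometry group of the standard Hermitian (`ε = 1`) or skew-Hermitian
(`ε = -1`) matrix over the coefficient algebra that the classification of the Clifford algebras
prescribes for `p - q = d` and `p + q = N`. -/
def HasFormType (d : ℤ) (N : ℕ) (ε : ℝ) (H : Type*) [Mul H] [TopologicalSpace H] : Prop :=
  CliffordTable (fun k K _ _ _ _ _ => ∃ m, N = 2 * m + k ∧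
    (ε = 1 → LieIso H (formGroup (signMatrix (2 ^ m) K))) ∧
    (ε = -1 → LieIso H (formGroup (skewMatrix (2 ^ m) K)))) d

variable {d : ℤ} {N : ℕ} {ε : ℝ}

theorem HasFormType.of_lieIso {H H' : Type*} [Mul H] [TopologicalSpace H] [Mul H']
    [TopologicalSpace H'] (h : HasFormType d N ε H') (e : LieIso H H') : HasFormType d N ε H := by
  refine CliffordTable.mono h fun k K _ _ _ _ _ => ?_
  rintro ⟨m, hm, sign, skew⟩
  exact ⟨m, hm, fun hε => e.trans (sign hε), fun hε => e.trans (skew hε)⟩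

theorem HasCliffordType.hasFormType {A B : Type*} [Ring A] [StarRing A] [Algebra ℝ A]
    [TopologicalSpace A] [IsModuleTopology ℝ A] [Ring B] [StarRing B] [Algebra ℝ B]
    (h : HasCliffordType d N B) {e : A ≃⋆ₐ[ℝ] Matrix (Fin 2) (Fin 2) B} {J : A}
    (sign : ε = 1 → e J = signTwo B) (skew : ε = -1 → e J = skewTwo B) :
    HasFormType d N ε (isomGroup J) := by
  refine CliffordTable.mono h fun k K _ _ _ _ _ => ?_
  rintro ⟨m, hm, ⟨f⟩⟩
  have iso := lieIso_isomGroup (doubleStarAlgEquiv e f) J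
  refine ⟨m, hm, fun hε => ?_, fun hε => ?_⟩
  · rwa [doubleStarAlgEquiv_eq_signMatrix (sign hε)] at iso
  · rwa [doubleStarAlgEquiv_eq_skewMatrix (skew hε)] at iso

theorem IsVolumeElement.hasFormType {p q : ℕ} {c : ℝ} {J : StarCl (p + 1) (q + 1)}
    (h : IsVolumeElement ε c J) : HasFormType ((p : ℤ) - q) (p + q) ε (isomGroup J) :=
  let ⟨_, sign, skew⟩ := h.exists_doubling
  (hasCliffordType_starCl p q).hasFormType sign skew

/-- The classical groups that appear in the table: `HasFormType`, with the isometry groups of the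
standard forms replaced by their names. -/
structure HasClassicalType (d : ℤ) (N : ℕ) (ε : ℝ) (H : Type*) [Mul H] [TopologicalSpace H] :
    Prop where
  real : d % 8 = 0 ∨ d % 8 = 2 → ∃ m, N = 2 * m ∧
    (ε = 1 → LieIso H (Onn (2 ^ m))) ∧ (ε = -1 → LieIso H (SpR (2 ^ m)))
  real_prod : d % 8 = 1 → ∃ m, N = 2 * m + 1 ∧ (ε = 1 → LieIso H (Onn (2 ^ m) × Onn (2 ^ m))) ∧
    (ε = -1 → LieIso H (SpR (2 ^ m) × SpR (2 ^ m)))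
  complex : d % 8 = 3 ∨ d % 8 = 7 → ∃ m, N = 2 * m + 1 ∧
    (ε = 1 ∨ ε = -1 → LieIso H (Unn (2 ^ m)))
  quaternion : d % 8 = 4 ∨ d % 8 = 6 → ∃ m, N = 2 * m + 2 ∧
    (ε = 1 → LieIso H (Spnn (2 ^ m))) ∧ (ε = -1 → LieIso H (OStar (2 * 2 ^ m)))
  quaternion_prod : d % 8 = 5 → ∃ m, N = 2 * m + 3 ∧
    (ε = 1 → LieIso H (Spnn (2 ^ m) × Spnn (2 ^ m))) ∧
    (ε = -1 → LieIso H (OStar (2 * 2 ^ m) × OStar (2 * 2 ^ m)))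

theorem HasFormType.hasClassicalType {H : Type*} [Mul H] [TopologicalSpace H]
    (h : HasFormType d N ε H) : HasClassicalType d N ε H where
  real hd :=
    let ⟨m, hm, sign, skew⟩ := h.1 hd
    ⟨m, hm, sign, fun hε => (skew hε).trans (lieIso_spR _)⟩
  real_prod hd :=
    let ⟨m, hm, sign, skew⟩ := h.2.1 hd
    ⟨m, hm, fun hε => (sign hε).trans (lieIso_formGroup_signMatrix_prod _),
      fun hε => ((skew hε).trans (lieIso_formGroup_skewMatrix_prod _)).trans
        ((lieIso_spR _).prod (lieIso_spR _))⟩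
  complex hd :=
    let ⟨m, hm, sign, skew⟩ := h.2.2.1 hd
    ⟨m, hm, fun hε => hε.elim sign fun hε => (skew hε).trans (lieIso_unn _)⟩
  quaternion hd :=
    let ⟨m, hm, sign, skew⟩ := h.2.2.2.1 hd
    ⟨m, hm, sign, fun hε => (skew hε).trans (lieIso_oStar _)⟩
  quaternion_prod hd :=
    let ⟨m, hm, sign, skew⟩ := h.2.2.2.2 hd
    ⟨m, hm, fun hε => (sign hε).trans (lieIso_formGroup_signMatrix_prod _),
      fun hε => ((skew hε).trans (lieIso_formGroup_skewMatrix_prod _)).trans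
        ((lieIso_oStar _).prod (lieIso_oStar _))⟩

theorem HasClassicalType.autTable {p q : ℕ} {H : Submonoid (Cl (p + 1) (q + 1))}
    {herm skew : Prop} (h : HasClassicalType ((p : ℤ) - q) (p + q) ε H) (hε : ε = 1 ∨ ε = -1)
    (herm_imp : herm → ε = 1) (skew_imp : skew → ε = -1) :
    AutTable (p + 1) (q + 1) H herm skew := by
  refine ⟨fun hd => ?_, fun hd => ?_, fun hd => ?_, fun hd => ?_, fun hd => ?_⟩ <;>
    simp only [PM8, Int.ModEq, Nat.cast_add, Nat.cast_one] at hd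
  · obtain ⟨m, hm, iso, iso'⟩ := h.real_prod (by omega)
    exact ⟨m, _, by omega, rfl, iso ∘ herm_imp, iso' ∘ skew_imp⟩
  · obtain ⟨m, hm, iso, iso'⟩ := h.real (by omega)
    exact ⟨m, _, by omega, rfl, iso ∘ herm_imp, iso' ∘ skew_imp⟩
  · obtain ⟨m, hm, iso⟩ := h.complex (by omega)
    exact ⟨m, _, by omega, rfl, iso hε⟩
  · obtain ⟨m, hm, iso, iso'⟩ := h.quaternion (by omega)
    exact ⟨m, _, by omega, rfl, iso ∘ herm_imp, iso' ∘ skew_imp⟩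
  · obtain ⟨m, hm, iso, iso'⟩ := h.quaternion_prod (by omega)
    exact ⟨m, _, by omega, rfl, iso ∘ herm_imp, iso' ∘ skew_imp⟩

theorem autTable_JPlus {p q : ℕ} (hp : 1 ≤ p) (hq : 1 ≤ q) :
    AutTable p q (AutJ (JPlus p q)) (p % 4 = 0 ∨ p % 4 = 1) (p % 4 = 2 ∨ p % 4 = 3) := by
  obtain ⟨p, rfl⟩ := Nat.exists_eq_add_of_le' hp
  obtain ⟨q, rfl⟩ := Nat.exists_eq_add_of_le' hq
  exact (isVolumeElement_volPlus p q).hasFormType.hasClassicalType.autTable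
    (H := AutJ (JPlus (p + 1) (q + 1))) (prodSign_one_eq_or _) prodSign_one_eq_one
    prodSign_one_eq_neg_one

theorem autTable_JMinus {p q : ℕ} (hp : 1 ≤ p) (hq : 1 ≤ q) :
    AutTable p q (AutJ (JMinus p q)) ((q + 1) % 4 = 0 ∨ (q + 1) % 4 = 1)
      ((q + 1) % 4 = 2 ∨ (q + 1) % 4 = 3) := by
  obtain ⟨p, rfl⟩ := Nat.exists_eq_add_of_le' hp
  obtain ⟨q, rfl⟩ := Nat.exists_eq_add_of_le' hq
  have h := isVolumeElement_volMinus p q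
  rw [prodSign_neg_one_eq_prodSign_one] at h
  exact h.hasFormType.hasClassicalType.autTable
    (H := AutJ (JMinus (p + 1) (q + 1))) (prodSign_one_eq_or _) prodSign_one_eq_one
    prodSign_one_eq_neg_one

end FormTable

section EvenSubalgebra

section Similitude

variable {R M N : Type*} [CommRing R] [AddCommGroup M] [Module R M] [AddCommGroup N] [Module R N]
  {Q : QuadraticForm R M} {Q' : QuadraticForm R N}

/-- The homomorphism of even Clifford algebras `v w ↦ c⁻¹ (e v) (e w)` induced by a similitude `e`
with multiplier `c`. -/
def evenMap (c : Rˣ) (e : M →ₗ[R] N) (h : ∀ x, Q' (e x) = c * Q x) : even Q →ₐ[R] even Q' :=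
  even.lift Q
    { bilin := (↑c⁻¹ : R) • (even.ι Q').bilin.compl₁₂ e e
      contract m := by
        simp [EvenHom.contract, h, Algebra.algebraMap_eq_smul_one, smul_smul]
      contract_mid m₁ m₂ m₃ := by
        simp [EvenHom.contract_mid, h, smul_smul, mul_comm, mul_left_comm] }

theorem coe_evenMap_ι (c : Rˣ) (e : M →ₗ[R] N) (h : ∀ x, Q' (e x) = c * Q x) (x y : M) :
    (evenMap c e h ((even.ι Q).bilin x y) : CliffordAlgebra Q') =
      (↑c⁻¹ : R) • (ι Q' (e x) * ι Q' (e y)) :=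
  congrArg Subtype.val (even.lift_ι Q _ x y)

theorem evenMap_comp_evenMap (c : Rˣ) (e : M ≃ₗ[R] N) (h : ∀ x, Q' (e x) = c * Q x)
    (h' : ∀ y, Q (e.symm y) = ↑c⁻¹ * Q' y) :
    (evenMap c⁻¹ e.symm.toLinearMap h').comp (evenMap c e.toLinearMap h) = AlgHom.id R _ := by
  ext x y : 4
  simp [evenMap, smul_smul]

theorem coe_evenMap_reverse (c : Rˣ) (e : M →ₗ[R] N) (h : ∀ x, Q' (e x) = c * Q x)
    {a b : even Q} (hab : (b : CliffordAlgebra Q) = reverse (a : CliffordAlgebra Q)) :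
    (evenMap c e h b : CliffordAlgebra Q') = reverse (evenMap c e h a : CliffordAlgebra Q') := by
  obtain ⟨a, ha⟩ := a
  induction a, ha using even_induction generalizing b with
  | algebraMap r =>
    obtain rfl : b = algebraMap R _ r := Subtype.ext (hab.trans (reverse.commutes r))
    change (evenMap c e h (algebraMap R _ r) : CliffordAlgebra Q') =
      reverse (evenMap c e h (algebraMap R _ r) : CliffordAlgebra Q')
    rw [AlgHom.commutes]
    exact (reverse.commutes r).symm
  | add x y hx hy ihx ihy =>
    let x' : even Q := ⟨reverse x, (reverse_mem_evenOdd_iff _).2 hx⟩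
    let y' : even Q := ⟨reverse y, (reverse_mem_evenOdd_iff _).2 hy⟩
    obtain rfl : b = x' + y' := Subtype.ext (hab.trans (map_add _ x y))
    change _ = reverse (evenMap c e h (⟨x, hx⟩ + ⟨y, hy⟩) : CliffordAlgebra Q')
    rw [map_add, map_add, Subalgebra.coe_add, Subalgebra.coe_add, ihx (b := x') rfl,
      ihy (b := y') rfl, map_add]
  | ι_mul_ι_mul v w x hx ih =>
    let x' : even Q := ⟨reverse x, (reverse_mem_evenOdd_iff _).2 hx⟩
    obtain rfl : b = x' * (even.ι Q).bilin w v :=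
      Subtype.ext (hab.trans (by simp [x', even.ι, mul_assoc]))
    change _ = reverse (evenMap c e h ((even.ι Q).bilin v w * ⟨x, hx⟩) : CliffordAlgebra Q')
    rw [map_mul, map_mul, Subalgebra.coe_mul, Subalgebra.coe_mul, reverse.map_mul, ih (b := x') rfl,
      coe_evenMap_ι, coe_evenMap_ι, map_smul, reverse.map_mul, reverse_ι, reverse_ι]

theorem exists_algEquiv_even_of_similitude (c : Rˣ) (e : (M × R) ≃ₗ[R] N)
    (h : ∀ x, Q' (e x) = c * EquivEven.Q' Q x) :
    ∃ f : CliffordAlgebra Q ≃ₐ[R] even Q', ∀ a,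
      (f (star a) : CliffordAlgebra Q') = reverse (f a : CliffordAlgebra Q') := by
  have h' (y : N) : EquivEven.Q' Q (e.symm y) = ↑c⁻¹ * Q' y := by
    rw [← c.inv_mul_cancel_left (EquivEven.Q' Q (e.symm y)), ← h, e.apply_symm_apply]
  refine ⟨(equivEven Q).trans (.ofAlgHom (evenMap c e.toLinearMap h)
    (evenMap c⁻¹ e.symm.toLinearMap h') ?_ (evenMap_comp_evenMap c e h h')), fun a => ?_⟩
  · exact evenMap_comp_evenMap c⁻¹ e.symm h' fun x => by simpa using h x
  · refine coe_evenMap_reverse c _ h ?_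
    rw [star_def]
    exact coe_toEven_reverse_involute Q a

end Similitude

variable {p q : ℕ}

/-- Appends a negative direction to `ℝ^{p,q}`. -/
def consRight (p q : ℕ) : ((Fin p ⊕ Fin q → ℝ) × ℝ) ≃ₗ[ℝ] (Fin p ⊕ Fin (q + 1) → ℝ) where
  toFun x := Sum.elim (x.1 ∘ .inl) (Fin.cons x.2 (x.1 ∘ .inr))
  invFun y := (Sum.elim (y ∘ .inl) (Fin.tail (y ∘ .inr)), y (.inr 0))
  map_add' x y := by
    ext (i | i)
    · rfl
    · induction i using Fin.cases <;> rfl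
  map_smul' c x := by
    ext (i | i)
    · rfl
    · induction i using Fin.cases <;> rfl
  left_inv x := by
    ext i
    · rcases i with i | i <;> rfl
    · rfl
  right_inv y := by
    ext (i | i)
    · rfl
    · induction i using Fin.cases <;> rfl

theorem stdForm_consRight (x : (Fin p ⊕ Fin q → ℝ) × ℝ) :
    stdForm p (q + 1) (consRight p q x) = stdForm p q x.1 - x.2 * x.2 := by
  simp only [stdForm, consRight, LinearEquiv.coe_mk, LinearMap.coe_mk, AddHom.coe_mk,
    QuadraticMap.weightedSumSquares_apply, Fintype.sum_sum_type, Sum.elim_inl, Sum.elim_inr,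
    Fin.sum_univ_succ, Fin.cons_zero, Fin.cons_succ, Function.comp_apply, smul_eq_mul]
  ring

theorem stdForm_funCongrLeft_sumComm (y : Fin p ⊕ Fin q → ℝ) :
    stdForm q p (LinearEquiv.funCongrLeft ℝ ℝ (Equiv.sumComm _ _) y) = -stdForm p q y := by
  simp [stdForm, QuadraticMap.weightedSumSquares_apply, LinearEquiv.funCongrLeft_apply, add_comm]

theorem exists_algEquiv_clEven (p q : ℕ) : ∃ f : Cl p q ≃ₐ[ℝ] ClEven p (q + 1), ∀ a,
    (f (star a) : Cl p (q + 1)) = reverse (f a : Cl p (q + 1)) :=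
  exists_algEquiv_even_of_similitude 1 (consRight p q) fun x => by
    rw [stdForm_consRight, Units.val_one, one_mul]
    rfl

theorem exists_algEquiv_clEven' (p q : ℕ) : ∃ f : Cl p q ≃ₐ[ℝ] ClEven (q + 1) p, ∀ a,
    (f (star a) : Cl (q + 1) p) = reverse (f a : Cl (q + 1) p) :=
  exists_algEquiv_even_of_similitude (-1)
    ((consRight p q).trans (LinearEquiv.funCongrLeft ℝ ℝ (Equiv.sumComm _ _))) fun x => by
    rw [LinearEquiv.trans_apply, stdForm_funCongrLeft_sumComm, stdForm_consRight, Units.val_neg,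
      Units.val_one, neg_one_mul]
    rfl

end EvenSubalgebra

section EvenCase

variable {p q : ℕ}

/-- Mathlib's `star` on a Clifford algebra is the conjugation `v ↦ -v`; reversal turns into it under
the identification of `C(p,q)` with an even Clifford algebra. -/
theorem lieIso_G_of_algEquiv {p' q' : ℕ} (f : Cl p q ≃ₐ[ℝ] ClEven p' q')
    (hf : ∀ a, (f (star a) : Cl p' q') = reverse (f a : Cl p' q')) :
    LieIso (G p' q') (isomGroup (1 : Cl p q)) := by
  refine (lieIso_of_algHom (H := isomGroup (1 : Cl p q)) (K := G p' q')
    (f := (ClEven p' q').val.comp f.toAlgHom) (Subtype.val_injective.comp f.injective)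
    (fun a => ?_) fun b hb =>
      ⟨f.symm ⟨b, hb.1⟩, congrArg Subtype.val (f.apply_symm_apply ⟨b, hb.1⟩)⟩).symm
  rw [mem_isomGroup_one]
  change _ ↔ (f a : Cl p' q') ∈ ClEven p' q' ∧ reverse (f a : Cl p' q') * f a = 1
  rw [← hf, ← Subalgebra.coe_mul, ← map_mul, and_iff_right (f a).2, OneMemClass.coe_eq_one,
    EmbeddingLike.map_eq_one_iff]

theorem lieIso_G (p q : ℕ) : LieIso (G p (q + 1)) (isomGroup (1 : Cl p q)) :=
  let ⟨f, hf⟩ := exists_algEquiv_clEven p q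
  lieIso_G_of_algEquiv f hf

theorem lieIso_G_swap (p q : ℕ) : LieIso (G (q + 1) p) (G p (q + 1)) :=
  let ⟨f, hf⟩ := exists_algEquiv_clEven' p q
  (lieIso_G_of_algEquiv f hf).trans (lieIso_G p q).symm

theorem algIso_clEven {B : Type*} [Ring B] [Algebra ℝ B] [Star B]
    (h : Nonempty (StarCl p q ≃⋆ₐ[ℝ] B)) : AlgIso (ClEven p (q + 1)) B :=
  let ⟨f, _⟩ := exists_algEquiv_clEven p q
  let ⟨e⟩ := h
  ⟨f.symm.trans e.toAlgEquiv⟩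

theorem mul_map_eq_starConj_mul {J : Cl p q} (σ : Cl p q →ₗ[ℝ] Cl p q) (σ_one : σ 1 = 1)
    (σ_mul : ∀ a b, σ (a * b) = σ b * σ a)
    (σ_gen : ∀ i, J * σ (stdGen p q i) = starConj (stdGen p q i : Cl p q) * J) (a : Cl p q) :
    J * σ a = starConj a * J := by
  have map_scalar (r : ℝ) : J * σ (algebraMap ℝ _ r) = starConj (algebraMap ℝ _ r) * J := by
    rw [Algebra.algebraMap_eq_smul_one, map_smul, σ_one, starConj_smul, starConj_one,
      mul_smul_one, smul_mul_assoc, one_mul]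
  have map_add {a b : Cl p q} (ha : J * σ a = starConj a * J) (hb : J * σ b = starConj b * J) :
      J * σ (a + b) = starConj (a + b) * J := by
    rw [map_add, mul_add, ha, hb, starConj_add, add_mul]
  have map_mul {a b : Cl p q} (ha : J * σ a = starConj a * J) (hb : J * σ b = starConj b * J) :
      J * σ (a * b) = starConj (a * b) * J := by
    rw [σ_mul, ← mul_assoc, hb, mul_assoc, ha, ← mul_assoc, starConj_mul]
  induction a using stdGen_induction with
  | algebraMap r => exact map_scalar r
  | gen i => exact σ_gen i
  | add a b ha hb => exact map_add ha hb
  | mul a b ha hb => exact map_mul ha hb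

theorem mem_AutJ_iff_of_mul_map_eq {J : Cl p q} {ε : ℝ} (hε : ε ≠ 0) (hJ : J * J = ε • 1)
    {σ : Cl p q → Cl p q} (hσ : ∀ a, J * σ a = starConj a * J) (a : Cl p q) :
    a ∈ AutJ J ↔ σ a * a = 1 := by
  have mul_cancel {x : Cl p q} (hx : J * x = J) : x = 1 := by
    refine smul_right_injective _ hε ?_
    change ε • x = ε • 1
    rw [← one_mul x, ← smul_mul_assoc, ← hJ, mul_assoc, hx]
  change starConj a * J * a = J ↔ _
  rw [← hσ, mul_assoc]
  exact ⟨mul_cancel, fun h => by rw [h, mul_one]⟩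

namespace IsVolumeElement

variable {ε : ℝ} {J : Cl (p + 1) (q + 1)}

theorem sign_ne_zero {c : ℝ} (h : IsVolumeElement ε c J) : ε ≠ 0 := by
  obtain rfl | rfl := h.eq_or <;> norm_num

theorem mul_gen_eq_star_mul {c : ℝ} {J : StarCl (p + 1) (q + 1)} (h : IsVolumeElement ε c J)
    (i : Fin (p + 1) ⊕ Fin (q + 1)) : J * stdGen _ _ i = c • (star (stdGen _ _ i) * J) := by
  rw [(isFrame_stdGen _ _).star_eq, smul_mul_assoc, smul_smul]
  exact h.mul_gen i

theorem mul_reverse (h : IsVolumeElement ε 1 J) (a : Cl (p + 1) (q + 1)) :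
    J * reverse a = starConj a * J := by
  refine mul_map_eq_starConj_mul reverse reverse.map_one reverse.map_mul (fun i => ?_) a
  rw [stdGen, reverse_ι]
  exact (h.mul_gen_eq_star_mul i).trans (one_smul _ _)

theorem mul_star (h : IsVolumeElement ε (-1) J) (a : Cl (p + 1) (q + 1)) :
    J * star a = starConj a * J := by
  refine mul_map_eq_starConj_mul (reverse.comp involute.toLinearMap) (by simp)
    (fun a b => by simp) (fun i => ?_) a
  change J * reverse (involute (ι _ _)) = _
  rw [involute_ι, map_neg, reverse_ι, mul_neg, neg_eq_iff_eq_neg]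
  exact (h.mul_gen_eq_star_mul i).trans (neg_one_smul _ _)

theorem G_eq_inf {c : ℝ} (h : IsVolumeElement ε c J) :
    G (p + 1) (q + 1) = (ClEven (p + 1) (q + 1)).toSubmonoid ⊓ AutJ J := by
  ext a
  refine and_congr_right fun (a_even : a ∈ ClEven (p + 1) (q + 1)) => Iff.symm ?_
  change a ∈ AutJ J ↔ _
  obtain rfl | rfl := mul_self_eq_one_iff.1 h.comm_mul_self
  · exact mem_AutJ_iff_of_mul_map_eq h.sign_ne_zero h.mul_self h.mul_reverse a
  · rw [mem_AutJ_iff_of_mul_map_eq h.sign_ne_zero h.mul_self h.mul_star a, star_def,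
      involute_eq_of_mem_even a_even]

theorem AutJ_eq_isomGroup_one (h : IsVolumeElement ε (-1) J) :
    AutJ J = isomGroup (1 : Cl (p + 1) (q + 1)) := by
  ext a
  rw [mem_isomGroup_one]
  exact mem_AutJ_iff_of_mul_map_eq h.sign_ne_zero h.mul_self h.mul_star a

end IsVolumeElement

theorem G_eq_inf_JPlus (hp : 1 ≤ p) (hq : 1 ≤ q) :
    G p q = (ClEven p q).toSubmonoid ⊓ AutJ (JPlus p q) := by
  obtain ⟨p, rfl⟩ := Nat.exists_eq_add_of_le' hp
  obtain ⟨q, rfl⟩ := Nat.exists_eq_add_of_le' hq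
  exact (isVolumeElement_volPlus p q).G_eq_inf

theorem G_eq_inf_JMinus (hp : 1 ≤ p) (hq : 1 ≤ q) :
    G p q = (ClEven p q).toSubmonoid ⊓ AutJ (JMinus p q) := by
  obtain ⟨p, rfl⟩ := Nat.exists_eq_add_of_le' hp
  obtain ⟨q, rfl⟩ := Nat.exists_eq_add_of_le' hq
  exact (isVolumeElement_volMinus p q).G_eq_inf

theorem hasFormType_G (hp : 1 ≤ p) (hq : 1 ≤ q) (even_q : Even q) :
    HasFormType ((p : ℤ) - q + 1) (p + q - 3) (prodSign 1 q) (G p q) := by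
  obtain ⟨p, rfl⟩ := Nat.exists_eq_add_of_le' hp
  obtain ⟨q, rfl⟩ := Nat.exists_eq_add_of_le' (even_q.two_dvd |> Nat.le_of_dvd hq)
  have h := isVolumeElement_volMinus p q
  rw [(show Odd (q + 1) by grind).neg_one_pow, prodSign_neg_one_eq_prodSign_one] at h
  have iso := lieIso_G (p + 1) (q + 1)
  rw [← h.AutJ_eq_isomGroup_one] at iso
  change HasFormType _ _ _ (G (p + 1) (q + 1 + 1))
  convert h.hasFormType.of_lieIso iso using 1
  · push_cast; ring
  · omega
  · rfl

theorem exists_hasClassicalType_G (hp : 1 ≤ p) (hq : 1 ≤ q) (h : Even p ∨ Even q) :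
    ∃ (d : ℤ) (r : ℕ), Even r ∧ (d = p - q + 1 ∧ r = q ∨ d = q - p + 1 ∧ r = p) ∧
      HasClassicalType d (p + q - 3) (prodSign 1 r) (G p q) := by
  obtain even_p | even_q := h
  · refine ⟨_, p, even_p, .inr ⟨rfl, rfl⟩, HasFormType.hasClassicalType ?_⟩
    rw [add_comm p q]
    obtain ⟨q, rfl⟩ := Nat.exists_eq_add_of_le' hq
    exact (hasFormType_G hq hp even_p).of_lieIso (lieIso_G_swap _ _).symm
  · exact ⟨_, q, even_q, .inl ⟨rfl, rfl⟩, (hasFormType_G hp hq even_q).hasClassicalType⟩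

end EvenCase

section OddOddCase

variable {p q : ℕ}

/-- The product `J₊J₋` of all the generators, which is central if `p + q` is odd. -/
def vol (p q : ℕ) : Cl p q := JPlus p q * JMinus p q

theorem volMinus_comm_volPlus (hq : Even q) :
    volMinus p q * volPlus p q = volPlus p q * volMinus p q := by
  rw [volPlus, mul_prod_ofFn (c := fun _ => 1), Finset.prod_const_one, one_smul]
  intro i
  simpa [hq.neg_one_pow] using volMinus_mul_gen p q (.inl i)

theorem vol_comm (h : Odd (p + q)) (a : Cl p q) : vol p q * a = a * vol p q := by
  have gen (i) : volPlus p q * volMinus p q * stdGen p q i =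
      stdGen p q i * (volPlus p q * volMinus p q) := by
    have sign : (-1) ^ q * stdSign p q i * ((-1) ^ (p + 1) * stdSign p q i) = 1 := by
      rw [mul_mul_mul_comm, (isFrame_stdGen p q).sign_mul_self, ← pow_add, mul_one]
      exact Even.neg_one_pow (by grind)
    rw [mul_assoc, volMinus_mul_gen, mul_smul_comm, ← mul_assoc, volPlus_mul_gen, smul_mul_assoc,
      smul_smul, sign, one_smul, mul_assoc]
  have comm (a : StarCl p q) :
      volPlus p q * volMinus p q * a = a * (volPlus p q * volMinus p q) := by
    induction a using stdGen_induction with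
    | algebraMap r => exact (Algebra.commutes r _).symm
    | gen i => exact gen i
    | add a b ha hb => rw [mul_add, ha, hb, add_mul]
    | mul a b ha hb => rw [← mul_assoc, ha, mul_assoc, hb, mul_assoc]
  exact comm a

theorem vol_mul_self (hq : Even q) : vol p q * vol p q = (prodSign 1 p * prodSign (-1) q) • 1 := by
  change volPlus p q * volMinus p q * (volPlus p q * volMinus p q) = _ • (1 : StarCl p q)
  rw [mul_assoc, ← mul_assoc (volMinus p q), volMinus_comm_volPlus hq, mul_assoc, ← mul_assoc,
    volPlus, volMinus, (isFrame_stdGen_inl p q).prod_mul_self,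
    (isFrame_stdGen_inr p q).prod_mul_self, smul_mul_smul_comm, one_mul]
  rfl

theorem starConj_vol (hq : Even q) :
    starConj (vol p q) = (prodSign 1 p * prodSign (-1) q) • vol p q := by
  change star (volPlus p q * volMinus p q) = _ • (volPlus p q * volMinus p q)
  rw [star_mul, volPlus, volMinus, (isFrame_stdGen_inl p q).star_prod,
    (isFrame_stdGen_inr p q).star_prod, smul_mul_smul_comm, mul_comm (prodSign 1 p)]
  exact congrArg _ (volMinus_comm_volPlus hq)

instance : StarModule ℝ (Cl p q) where
  star_smul := CliffordAlgebra.star_smul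

theorem star_vol_mul_self (p q : ℕ) : star (vol p q) * vol p q = (-1 : ℝ) ^ p • 1 := by
  have plus (i : Fin p) : star (vPlus i : Cl p q) * vPlus i = (-1 : ℝ) • 1 := by
    rw [vPlus, star_ι, neg_mul, neg_one_smul]
    exact congrArg _ (stdGen_inl_mul_self i)
  have minus (j : Fin q) : star (vMinus j : Cl p q) * vMinus j = (1 : ℝ) • 1 := by
    rw [vMinus, star_ι, neg_mul, one_smul]
    exact neg_eq_iff_eq_neg.2 (stdGen_inr_mul_self j)
  rw [vol, star_mul, mul_assoc, ← mul_assoc (star (JPlus p q)), JPlus, JMinus,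
    star_prod_ofFn_mul_self plus, smul_mul_assoc, one_mul, mul_smul_comm,
    star_prod_ofFn_mul_self minus, one_pow, one_smul]

end OddOddCase

section SwappedFactors

theorem eq_one_or_eq_neg_one_of_central {M : Type*} [Ring M] [IsSimpleRing M] {w : M}
    (comm : ∀ x, w * x = x * w) (hw : w * w = 1) : w = 1 ∨ w = -1 := by
  let := (IsSimpleRing.isField_center M).toField
  have central : w ∈ Subring.center M := Subring.mem_center_iff.2 fun x => (comm x).symm
  simpa [Subtype.ext_iff] using
    mul_self_eq_one_iff (a := (⟨w, central⟩ : Subring.center M)).1 (Subtype.ext hw)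

variable {A M : Type*} [Ring A] [StarRing A] [Algebra ℝ A] [StarModule ℝ A] [Ring M] [Algebra ℝ M]
  [FiniteDimensional ℝ M]

theorem lieIso_units_of_bijective [TopologicalSpace A] [IsModuleTopology ℝ A] [TopologicalSpace M]
    [IsModuleTopology ℝ M] (π : A →ₐ[ℝ] M) (hπ : Function.Bijective fun a => (π a, π (star a))) :
    LieIso (isomGroup (1 : A)) Mˣ := by
  have := IsModuleTopology.topologicalAddGroup ℝ A
  have := IsModuleTopology.topologicalAddGroup ℝ M
  have := IsModuleTopology.toContinuousSMul ℝ A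
  have := IsModuleTopology.toContinuousSMul ℝ M
  have := IsArtinianRing.of_finite ℝ M
  have star_mul_self {a : A} : star a * a = 1 ↔ π (star a) * π a = 1 := by
    refine ⟨fun h => by rw [← map_mul, h, map_one], fun h => hπ.1 ?_⟩
    simp only [star_mul, star_star, map_mul, h, map_one, star_one]
  let πStar : A →ₗ[ℝ] M := π.toLinearMap ∘ₗ (starLinearEquiv ℝ (A := A)).toLinearMap
  let E : A ≃ₗ[ℝ] M × M := .ofBijective (π.toLinearMap.prod πStar) hπ
  have continuous_π : Continuous π := IsModuleTopology.continuous_of_linearMap π.toLinearMap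
  have continuous_πStar : Continuous πStar := IsModuleTopology.continuous_of_linearMap πStar
  have continuous_symm : Continuous E.symm :=
    IsModuleTopology.continuous_of_linearMap E.symm.toLinearMap
  have E_symm (u : Mˣ) : π (E.symm (u, ↑u⁻¹)) = u ∧ π (star (E.symm (u, ↑u⁻¹))) = ↑u⁻¹ :=
    Prod.ext_iff.1 (E.apply_symm_apply _)
  have inverse (a : isomGroup (1 : A)) : π (star a) * π a = 1 :=
    star_mul_self.1 (mem_isomGroup_one.1 a.2)
  exact ⟨{
    toFun a := ⟨π a, π (star a), mul_eq_one_comm.1 (inverse a), inverse a⟩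
    invFun u := ⟨E.symm (u, ↑u⁻¹), mem_isomGroup_one.2 <| star_mul_self.2 <| by
      rw [(E_symm u).1, (E_symm u).2, Units.inv_mul]⟩
    left_inv a := Subtype.ext (E.symm_apply_apply a)
    right_inv u := Units.ext (E_symm u).1
    map_mul' a b := Units.ext (map_mul π (a : A) b)
    continuous_toFun := Units.continuous_iff.2
      ⟨continuous_π.comp continuous_subtype_val, continuous_πStar.comp continuous_subtype_val⟩
    continuous_invFun := (continuous_symm.comp
      (Units.continuous_val.prodMk Units.continuous_coe_inv)).subtype_mk _ }⟩

theorem bijective_fst_of_map_eq {e : A ≃ₐ[ℝ] M × M} {w : A} (he : e w = (1, -1))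
    (star_w : star w = -w) : Function.Bijective fun a => ((e a).1, (e (star a)).1) := by
  have := IsAddTorsionFree.of_isTorsionFree ℝ A
  have finrank_eq : Module.finrank ℝ A = Module.finrank ℝ (M × M) := e.toLinearEquiv.finrank_eq
  have := e.symm.toLinearEquiv.finiteDimensional
  let π : A →ₗ[ℝ] M := LinearMap.fst ℝ M M ∘ₗ e.toLinearMap
  let E : A →ₗ[ℝ] M × M := π.prod (π ∘ₗ (starLinearEquiv ℝ (A := A)).toLinearMap)
  have mul_eq_neg {a : A} (h : (e a).1 = 0) : w * a = -a ∧ a * w = -a := by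
    constructor <;> apply e.injective <;> ext <;> simp [he, h]
  have ker_eq_bot : LinearMap.ker E = ⊥ := by
    refine LinearMap.ker_eq_bot'.2 fun a ha => ?_
    obtain ⟨h, h_star⟩ : (e a).1 = 0 ∧ (e (star a)).1 = 0 := Prod.ext_iff.1 ha
    have eq : a = -a := by
      simpa [star_w, (mul_eq_neg h).1] using congrArg star (mul_eq_neg h_star).2
    exact self_eq_neg.1 eq
  have inj := LinearMap.ker_eq_bot.1 ker_eq_bot
  exact ⟨inj, (LinearMap.injective_iff_surjective_of_finrank_eq_finrank finrank_eq).1 inj⟩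

theorem lieIso_units_of_central [TopologicalSpace A] [IsModuleTopology ℝ A] [TopologicalSpace M]
    [IsModuleTopology ℝ M] [IsSimpleRing M] (e : A ≃ₐ[ℝ] M × M) {w : A}
    (comm : ∀ a, w * a = a * w) (hw : w * w = 1) (star_w : star w = -w) :
    LieIso (isomGroup (1 : A)) Mˣ := by
  have lieIso_of_map_eq {w : A} (he : e w = (1, -1)) (star_w : star w = -w) :
      LieIso (isomGroup (1 : A)) Mˣ :=
    lieIso_units_of_bijective ((AlgHom.fst ℝ M M).comp e.toAlgHom)
      (bijective_fst_of_map_eq he star_w)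
  have comm' (x : M × M) : e w * x = x * e w := by
    rw [← e.apply_symm_apply x, ← map_mul, comm, map_mul]
  have hw' : e w * e w = 1 := by rw [← map_mul, hw, map_one]
  have := IsAddTorsionFree.of_isTorsionFree ℝ A
  have star_w_ne : star w ≠ w := by
    intro h
    have : w = 0 := self_eq_neg.1 (h.symm.trans star_w)
    have := e.nontrivial
    simp [*] at hw
  have fst := eq_one_or_eq_neg_one_of_central (w := (e w).1)
    (fun x => congrArg Prod.fst (comm' (x, 0))) (congrArg Prod.fst hw')
  have snd := eq_one_or_eq_neg_one_of_central (w := (e w).2)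
    (fun x => congrArg Prod.snd (comm' (0, x))) (congrArg Prod.snd hw')
  rcases fst with fst | fst <;> rcases snd with snd | snd
  · have : w = 1 := e.injective (by rw [map_one]; exact Prod.ext fst snd)
    simp [this] at star_w_ne
  · exact lieIso_of_map_eq (Prod.ext fst snd) star_w
  · refine lieIso_of_map_eq (w := -w) ?_ (by rw [star_neg, star_w])
    rw [map_neg]
    exact Prod.ext (by simp [fst]) (by simp [snd])
  · have : w = -1 := e.injective (by rw [map_neg, map_one]; exact Prod.ext fst snd)
    simp [this] at star_w_ne

end SwappedFactors

section GeneralLinear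

variable {p q : ℕ}

theorem prodSign_mul_prodSign_eq_one (hq : Even q) (h : (p + q) % 4 = 1) :
    prodSign 1 p * prodSign (-1) q = 1 := by
  rw [prodSign_neg_one_eq_prodSign_one]
  obtain hq' | hq' : q % 4 = 0 ∨ q % 4 = 2 := by grind
  · rw [prodSign_one_eq_one (by omega), prodSign_one_eq_one (by omega), one_mul]
  · rw [prodSign_one_eq_neg_one (by omega), prodSign_one_eq_neg_one (by omega), neg_mul_neg,
      one_mul]

theorem prodSign_mul_prodSign_eq_neg_one (hq : Even q) (h : (p + q) % 4 = 3) :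
    prodSign 1 p * prodSign (-1) q = -1 := by
  rw [prodSign_neg_one_eq_prodSign_one]
  obtain hq' | hq' : q % 4 = 0 ∨ q % 4 = 2 := by grind
  · rw [prodSign_one_eq_neg_one (by omega), prodSign_one_eq_one (by omega), mul_one]
  · rw [prodSign_one_eq_one (by omega), prodSign_one_eq_neg_one (by omega), one_mul]

theorem smul_star_vol (hq : Even q) :
    (prodSign 1 p * prodSign (-1) q) • star (vol p q) = (-1 : ℝ) ^ p • vol p q := by
  rw [← mul_one (star (vol p q)), ← mul_smul_comm, ← vol_mul_self hq, ← mul_assoc,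
    star_vol_mul_self, smul_mul_assoc, one_mul]

theorem lieIso_G_units {M : Type*} [Ring M] [Algebra ℝ M] [TopologicalSpace M]
    [IsModuleTopology ℝ M] [FiniteDimensional ℝ M] [IsSimpleRing M] (hq : Even q)
    (h : (p + q) % 4 = 1) (e : Cl p q ≃ₐ[ℝ] M × M) : LieIso (G p (q + 1)) Mˣ := by
  have sign := prodSign_mul_prodSign_eq_one hq h
  have vol_mul_self := vol_mul_self (p := p) hq
  have star_vol := smul_star_vol (p := p) hq
  rw [sign, one_smul] at vol_mul_self star_vol
  rw [(show Odd p by grind).neg_one_pow, neg_one_smul] at star_vol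
  exact (lieIso_G p q).trans
    (lieIso_units_of_central e (vol_comm (by grind)) vol_mul_self star_vol)

theorem exists_lieIso_G_GLR (hq : Odd q) (h : (p - q : ℤ) % 8 = 0) :
    ∃ m, p + q = 2 * m + 2 ∧ LieIso (G p q) (GLR (2 ^ m)) := by
  obtain ⟨q, rfl⟩ := Nat.exists_eq_add_of_le' (show 1 ≤ q by grind)
  obtain ⟨m, hm, ⟨e⟩⟩ := (hasCliffordType_starCl p q).2.1 (by push_cast at h; omega)
  exact ⟨m, by omega,
    lieIso_G_units (by grind) (by grind) (e.trans (matrixProdStarAlgEquiv _ ℝ ℝ)).toAlgEquiv⟩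

theorem exists_lieIso_G_GLH (hq : Odd q) (h : (p - q : ℤ) % 8 = 4) :
    ∃ m, p + q = 2 * m + 4 ∧ LieIso (G p q) (GLH (2 ^ m)) := by
  obtain ⟨q, rfl⟩ := Nat.exists_eq_add_of_le' (show 1 ≤ q by grind)
  obtain ⟨m, hm, ⟨e⟩⟩ := (hasCliffordType_starCl p q).2.2.2.2 (by push_cast at h; omega)
  exact ⟨m, by omega,
    lieIso_G_units (by grind) (by grind) (e.trans (matrixProdStarAlgEquiv _ ℍ[ℝ] ℍ[ℝ])).toAlgEquiv⟩

end GeneralLinear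

section BilinearForms

/-- The matrices that preserve the bilinear form `(x, y) ↦ xᵀ B y`; this is `formGroup B` for the
trivial involution of the coefficients. -/
def bilinFormGroup {m F : Type*} [Fintype m] [DecidableEq m] [CommRing F] (B : Matrix m m F) :
    Submonoid (Matrix m m F) :=
  letI : StarRing F := starRingOfComm
  formGroup B

variable {m F : Type*} [Fintype m] [DecidableEq m] [CommRing F]

theorem mem_bilinFormGroup {B X : Matrix m m F} :
    X ∈ bilinFormGroup B ↔ X.transpose * B * X = B := Iff.rfl

variable [Algebra ℝ F] [TopologicalSpace F] [IsModuleTopology ℝ F]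

theorem lieIso_bilinFormGroup_conj (P : (Matrix m m F)ˣ) (B : Matrix m m F) :
    LieIso (bilinFormGroup B)
      (bilinFormGroup ((P : Matrix m m F).transpose * B * (P : Matrix m m F))) := by
  let : StarRing F := starRingOfComm
  exact lieIso_isomGroup_conj P B

theorem lieIso_bilinFormGroup_one_reindex {m' : Type*} [Fintype m'] [DecidableEq m'] (e : m ≃ m') :
    LieIso (bilinFormGroup (1 : Matrix m m F)) (bilinFormGroup (1 : Matrix m' m' F)) := by
  let : StarRing F := starRingOfComm
  have h := lieIso_isomGroup (reindexStarAlgEquiv F e) (1 : Matrix m m F)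
  rw [map_one] at h
  exact h

theorem bilinFormGroup_one (n : ℕ) : bilinFormGroup (1 : Mat n ℂ) = OC n := by
  ext X
  rw [mem_bilinFormGroup, mul_one, Matrix.mem_orthogonalGroup_iff']

theorem bilinFormGroup_skewMatrix (n : ℕ) : bilinFormGroup (skewMatrix n ℂ) = SpC n := by
  ext X
  rw [mem_bilinFormGroup, SymplecticGroup.mem_iff']
  rfl

theorem lieIso_bilinFormGroup_signMatrix (n : ℕ) :
    LieIso (bilinFormGroup (signMatrix n ℂ)) (OC (2 * n)) := by
  let P : Matrix (Fin n ⊕ Fin n) (Fin n ⊕ Fin n) ℂ :=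
    Matrix.diagonal (Sum.elim 1 fun _ => Complex.I)
  have conj_sign : P.transpose * signMatrix n ℂ * P = 1 := by
    ext (i | i) (j | j) <;> simp [P, signMatrix, Matrix.one_apply, neg_ite]
  have isUnit_P : IsUnit P := by simp [P, Matrix.isUnit_diagonal, Pi.isUnit_iff]
  have h := lieIso_bilinFormGroup_conj isUnit_P.unit (signMatrix n ℂ)
  rw [isUnit_P.unit_spec, conj_sign] at h
  rw [← bilinFormGroup_one]
  exact h.trans
    (lieIso_bilinFormGroup_one_reindex (finSumFinEquiv.trans (finCongr (two_mul n).symm)))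

end BilinearForms

section Complexification

variable {A m : Type*} [Ring A] [Algebra ℝ A] [Fintype m] [DecidableEq m]

theorem liftAux_commute {w a : A} (hw : w * w = -1) (h : w * a = a * w) (z : ℂ) :
    Commute (Complex.liftAux w hw z) a := by
  rw [Complex.liftAux_apply]
  exact (Algebra.commute_algebraMap_left _ _).add_left (Commute.smul_left h _)

/-- The extension to complex matrices of an algebra homomorphism on real matrices, by a square root
of `-1` that commutes with its image. -/
def complexify (ψ : Matrix m m ℝ →ₐ[ℝ] A) {w : A} (hw : w * w = -1)
    (comm : ∀ Y, w * ψ Y = ψ Y * w) : Matrix m m ℂ →ₐ[ℝ] A :=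
  (Algebra.TensorProduct.lift (Complex.liftAux w hw) ψ fun z Y =>
    liftAux_commute hw (comm Y) z).comp (matrixEquivTensor m ℝ ℂ).toAlgHom

variable {ψ : Matrix m m ℝ →ₐ[ℝ] A} {w : A} (hw : w * w = -1) (comm : ∀ Y, w * ψ Y = ψ Y * w)

theorem complexify_smul_map (z : ℂ) (Y : Matrix m m ℝ) :
    complexify ψ hw comm (z • Y.map Complex.ofReal) = Complex.liftAux w hw z * ψ Y := by
  rw [complexify, AlgHom.comp_apply,
    show (matrixEquivTensor m ℝ ℂ).toAlgHom (z • Y.map Complex.ofReal) = z ⊗ₜ Y from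
      (matrixEquivTensor m ℝ ℂ).apply_symm_apply (z ⊗ₜ Y), Algebra.TensorProduct.lift_tmul]

theorem complexify_map (Y : Matrix m m ℝ) : complexify ψ hw comm (Y.map Complex.ofReal) = ψ Y := by
  simpa using complexify_smul_map hw comm 1 Y

theorem complexMatrix_induction {k : Type*} [Finite k] {P : Matrix k k ℂ → Prop} (zero : P 0)
    (smul_map : ∀ (z : ℂ) (Y : Matrix k k ℝ), P (z • Y.map Complex.ofReal))
    (add : ∀ X Y, P X → P Y → P (X + Y)) (X : Matrix k k ℂ) : P X := by
  classical
  have := Fintype.ofFinite k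
  rw [← (matrixEquivTensor k ℝ ℂ).symm_apply_apply X]
  induction matrixEquivTensor k ℝ ℂ X with
  | zero => rwa [map_zero]
  | tmul z Y => exact smul_map z Y
  | add x y hx hy => rw [map_add]; exact add _ _ hx hy

theorem complexify_bijective [Nonempty m] [Nontrivial A] [FiniteDimensional ℝ A]
    (finrank_eq : Module.finrank ℝ A = Module.finrank ℝ (Matrix m m ℂ)) :
    Function.Bijective (complexify ψ hw comm) := by
  have inj := RingHom.injective (complexify ψ hw comm).toRingHom
  exact ⟨inj, (LinearMap.injective_iff_surjective_of_finrank_eq_finrank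
    (f := (complexify ψ hw comm).toLinearMap) finrank_eq.symm).1 inj⟩

variable [StarRing A] [StarModule ℝ A] {S : Matrix m m ℝ}

theorem mul_star_complexify (star_w : star w = w)
    (hS : ∀ Y, ψ S * star (ψ Y) = ψ Y.transpose * ψ S) (X : Matrix m m ℂ) :
    ψ S * star (complexify ψ hw comm X) = complexify ψ hw comm X.transpose * ψ S := by
  induction X using complexMatrix_induction with
  | zero => simp
  | smul_map z Y =>
    have star_lift : star (Complex.liftAux w hw z) = Complex.liftAux w hw z := by
      simp [Complex.liftAux_apply, star_w, Algebra.algebraMap_eq_smul_one]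
    have lift_comm : Commute (Complex.liftAux w hw z) (ψ Y.transpose * ψ S) := by
      rw [← map_mul]
      exact liftAux_commute hw (comm _) z
    rw [Matrix.transpose_smul, ← Matrix.transpose_map, complexify_smul_map, complexify_smul_map,
      star_mul, star_lift, ← mul_assoc, hS, mul_assoc _ _ (ψ S), lift_comm.eq]
  | add X Y hX hY => simp only [map_add, star_add, mul_add, hX, hY, Matrix.transpose_add, add_mul]

theorem lieIso_bilinFormGroup_of_complexify [TopologicalSpace A] [IsModuleTopology ℝ A] [Nonempty m]
    [Nontrivial A] [FiniteDimensional ℝ A] (hw : w * w = -1) (comm : ∀ Y, w * ψ Y = ψ Y * w)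
    (finrank_eq : Module.finrank ℝ A = Module.finrank ℝ (Matrix m m ℂ)) (star_w : star w = w)
    (isUnit_S : IsUnit S) (hS : ∀ Y, ψ S * star (ψ Y) = ψ Y.transpose * ψ S) :
    LieIso (isomGroup (1 : A)) (bilinFormGroup (S.map Complex.ofReal)) := by
  have bij := complexify_bijective hw comm finrank_eq
  refine (lieIso_of_algEquiv (AlgEquiv.ofBijective _ bij) fun X => ?_).symm
  rw [mem_bilinFormGroup, mem_isomGroup_one, AlgEquiv.ofBijective_apply, ← bij.1.eq_iff, map_mul,
    map_mul, complexify_map, ← mul_star_complexify hw comm star_w hS, mul_assoc]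
  exact (isUnit_S.map ψ).mul_eq_left

end Complexification

section ComplexCase

variable {p q p' q' : ℕ}

theorem vol_mul_self_eq_neg_one (hq : Even q) (h : (p + q) % 4 = 3) : vol p q * vol p q = -1 := by
  rw [vol_mul_self hq, prodSign_mul_prodSign_eq_neg_one hq h, neg_one_smul]

theorem star_vol_eq_self (hq : Even q) (h : (p + q) % 4 = 3) : star (vol p q) = vol p q := by
  have := smul_star_vol (p := p) hq
  rwa [prodSign_mul_prodSign_eq_neg_one hq h, (show Odd p by grind).neg_one_pow, neg_one_smul,
    neg_one_smul, neg_inj] at this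

/-- The factor `J₊J₋`, a central square root of `-1`, corrects the generators of the wrong sign. -/
theorem isFrame_twist_vol (hq : Even q) (h : (p + q) % 4 = 3)
    (u : Fin p' ⊕ Fin q' ↪ Fin p ⊕ Fin q) :
    IsFrame (stdSign p' q') fun i => if stdSign p q (u i) ≠ stdSign p' q' i
      then stdGen p q (u i) * (volPlus p q * volMinus p q) else stdGen p q (u i) := by
  let w : StarCl p q := volPlus p q * volMinus p q
  have comm (a : StarCl p q) : w * a = a * w := vol_comm (by grind) a
  have mul_self : w * w = (-1 : ℝ) • 1 := by
    rw [neg_one_smul]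
    exact vol_mul_self_eq_neg_one hq h
  have star_eq : star w = (-1 : ℝ) • w := by
    have := starConj_vol (p := p) hq
    rwa [prodSign_mul_prodSign_eq_neg_one hq h] at this
  refine (((isFrame_stdGen p q).comp u.injective).twist (γ := -1) (δ := 1) _ (by norm_num)
    (by norm_num) mul_self star_eq (fun i _ => ?_) (fun i _ => comm _)).congr fun i => ?_
  · rw [one_smul]
    exact comm _
  · have hu := (isFrame_stdGen p q).sign_mul_self (u i)
    have hi := (isFrame_stdGen p' q').sign_mul_self i
    rcases mul_self_eq_one_iff.1 hu with hu | hu <;>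
      rcases mul_self_eq_one_iff.1 hi with hi | hi <;> norm_num [hu, hi]

theorem exists_algHom_map_star (hq : Even q) (h : (p + q) % 4 = 3) (card_le : p' + q' ≤ p + q) :
    ∃ ρ : Cl p' q' →ₐ[ℝ] Cl p q, ∀ a, ρ (star a) = star (ρ a) := by
  obtain ⟨u⟩ : Nonempty (Fin p' ⊕ Fin q' ↪ Fin p ⊕ Fin q) :=
    Function.Embedding.nonempty_of_card_le (by simpa using card_le)
  obtain ⟨f, hf⟩ := (isFrame_twist_vol hq h u).exists_starAlgHom
  let ρ : Cl p' q' →ₐ[ℝ] Cl p q := f.toAlgHom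
  let gen (p q : ℕ) (i : Fin p ⊕ Fin q) : Cl p q := stdGen p q i
  have star_gen (p q : ℕ) (i) : star (gen p q i) = -gen p q i := star_ι _
  have star_ρ_gen (i) : star (ρ (gen p' q' i)) = -ρ (gen p' q' i) := by
    have ρ_gen : ρ (gen p' q' i) = if stdSign p q (u i) ≠ stdSign p' q' i
      then gen p q (u i) * vol p q else gen p q (u i) := hf i
    rw [ρ_gen]
    split_ifs
    · rw [star_mul, star_vol_eq_self hq h, star_gen, mul_neg, vol_comm (by grind)]
    · exact star_gen _ _ _
  have star_ρ_algebraMap (r : ℝ) : ρ (star (algebraMap ℝ (Cl p' q') r)) =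
      star (ρ (algebraMap ℝ (Cl p' q') r)) := by
    rw [CliffordAlgebra.star_algebraMap, AlgHom.commutes, CliffordAlgebra.star_algebraMap]
  have star_ρ_add {a b : Cl p' q'} (ha : ρ (star a) = star (ρ a)) (hb : ρ (star b) = star (ρ b)) :
      ρ (star (a + b)) = star (ρ (a + b)) := by
    rw [star_add, map_add, map_add, star_add, ha, hb]
  have star_ρ_mul {a b : Cl p' q'} (ha : ρ (star a) = star (ρ a)) (hb : ρ (star b) = star (ρ b)) :
      ρ (star (a * b)) = star (ρ (a * b)) := by
    rw [star_mul, map_mul, map_mul, star_mul, ha, hb]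
  refine ⟨ρ, fun a => ?_⟩
  induction a using stdGen_induction with
  | algebraMap r => exact star_ρ_algebraMap r
  | gen i => exact (congrArg ρ (star_gen _ _ i)).trans ((map_neg ρ _).trans (star_ρ_gen i).symm)
  | add a b ha hb => exact star_ρ_add ha hb
  | mul a b ha hb => exact star_ρ_mul ha hb

theorem IsVolumeElement.isUnit {ε c : ℝ} {J : StarCl (p + 1) (q + 1)}
    (h : IsVolumeElement ε c J) : IsUnit J := by
  have mul_smul_self : J * (ε • J) = 1 := by
    rw [mul_smul_comm, h.mul_self, smul_smul, mul_self_eq_one_iff.2 h.eq_or, one_smul]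
  exact ⟨⟨J, ε • J, mul_smul_self, by rw [smul_mul_assoc, ← mul_smul_comm, mul_smul_self]⟩, rfl⟩

theorem IsVolumeElement.lieIso_bilinFormGroup {m : Type*} [Fintype m] [DecidableEq m] [Nonempty m]
    {ε : ℝ} {J : StarCl (p' + 1) (q' + 1)} (hJ : IsVolumeElement ε (-1) J)
    (e : StarCl (p' + 1) (q' + 1) ≃⋆ₐ[ℝ] Matrix m m ℝ) (hq : Even q) (h : (p + q) % 4 = 3)
    (card_eq : p + q = p' + q' + 3) :
    LieIso (isomGroup (1 : Cl p q)) (bilinFormGroup ((e J).map Complex.ofReal)) := by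
  obtain ⟨ρ, ρ_star⟩ := exists_algHom_map_star (p' := p' + 1) (q' := q' + 1) hq h (by omega)
  have finrank_eq : Module.finrank ℝ (Cl p q) = Module.finrank ℝ (Matrix m m ℂ) := by
    have card_mul_card : Fintype.card m * Fintype.card m = 2 ^ (p' + 1 + (q' + 1)) := by
      rw [← finrank_starCl, LinearEquiv.finrank_eq e.toAlgEquiv.toLinearEquiv,
        Module.finrank_matrix, Module.finrank_self, mul_one]
    rw [Module.finrank_matrix, card_mul_card, Complex.finrank_real_complex, ← pow_succ]
    exact (finrank_starCl p q).trans (by rw [card_eq]; ring_nf)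
  have : FiniteDimensional ℝ (Cl p q) := inferInstanceAs (FiniteDimensional ℝ (StarCl p q))
  let ψ : Matrix m m ℝ →ₐ[ℝ] Cl p q := ρ.comp e.symm.toAlgEquiv.toAlgHom
  refine lieIso_bilinFormGroup_of_complexify (ψ := ψ) (vol_mul_self_eq_neg_one hq h)
    (fun _ => vol_comm (by grind) _) finrank_eq (star_vol_eq_self hq h) (hJ.isUnit.map e)
    fun Y => ?_
  let J' : Cl (p' + 1) (q' + 1) := J
  let a : Cl (p' + 1) (q' + 1) := e.symm Y
  have symm_transpose : e.symm Y.transpose = starConj a := by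
    rw [← Matrix.conjTranspose_eq_transpose_of_trivial]
    exact map_star e.symm Y
  have symm_J : e.symm (e J) = J' := e.symm_apply_apply J
  have hJ' : J' * star a = starConj a * J' := hJ.mul_star a
  change ρ (e.symm (e J)) * star (ρ a) = ρ (e.symm Y.transpose) * ρ (e.symm (e J))
  rw [symm_J, symm_transpose, ← ρ_star, ← map_mul, ← map_mul, hJ']

theorem signMatrix_map_ofReal (n : ℕ) : (signMatrix n ℝ).map Complex.ofReal = signMatrix n ℂ := by
  simp [signMatrix, Matrix.fromBlocks_map, Matrix.map_neg]

theorem skewMatrix_map_ofReal (n : ℕ) : (skewMatrix n ℝ).map Complex.ofReal = skewMatrix n ℂ := by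
  simp [skewMatrix, Matrix.fromBlocks_map, Matrix.map_neg]

theorem exists_lieIso_G_OC_SpC (hq : Odd q) (h : (p + q) % 4 = 0) :
    ∃ m, p + q = 2 * m + 4 ∧ ((p + q) % 8 = 0 → LieIso (G p q) (OC (2 * 2 ^ m))) ∧
      ((p + q) % 8 = 4 → LieIso (G p q) (SpC (2 ^ m))) := by
  obtain ⟨q, rfl⟩ := Nat.exists_eq_add_of_le' (show 1 ≤ q by grind)
  obtain ⟨m, hm⟩ : ∃ m, p + q = m + m + 3 := ⟨(p + q - 3) / 2, by grind⟩
  have hJ := isVolumeElement_volMinus m m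
  rw [(show Odd (m + 1) by grind).neg_one_pow, prodSign_neg_one_eq_prodSign_one] at hJ
  obtain ⟨e, sign, skew⟩ := hJ.exists_doubling
  obtain ⟨k, hk, ⟨f⟩⟩ := (hasCliffordType_starCl m m).1 (by omega)
  obtain rfl : m = k := by omega
  have iso := (lieIso_G p q).trans
    (hJ.lieIso_bilinFormGroup (doubleStarAlgEquiv e f) (by grind) (by omega) hm)
  refine ⟨m, by omega, fun h8 => ?_, fun h8 => ?_⟩
  · rw [doubleStarAlgEquiv_eq_signMatrix (sign (prodSign_one_eq_one (by omega))),
      signMatrix_map_ofReal] at iso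
    exact iso.trans (lieIso_bilinFormGroup_signMatrix _)
  · rwa [doubleStarAlgEquiv_eq_skewMatrix (skew (prodSign_one_eq_neg_one (by omega))),
      skewMatrix_map_ofReal, bilinFormGroup_skewMatrix] at iso

end ComplexCase

section Tables

variable {p q : ℕ}

theorem cliffordTable_algIso_clEven (hq : 1 ≤ q) :
    CliffordTable (fun k K _ _ _ _ _ => ∃ m, p + q = 2 * m + k + 1 ∧
      AlgIso (ClEven p q) (Mat (2 ^ m) K)) ((p : ℤ) - q + 1) := by
  obtain ⟨q, rfl⟩ := Nat.exists_eq_add_of_le' hq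
  have h : HasCliffordType ((p : ℤ) - (q + 1 : ℕ) + 1) (p + q) (StarCl p q) := by
    convert hasCliffordType_starCl p q using 1
    push_cast
    ring
  refine h.mono fun k K _ _ _ _ _ => ?_
  rintro ⟨m, hm, e⟩
  exact ⟨m, by omega, algIso_clEven e⟩

theorem classification_of_sub_modEq_zero (hp : 1 ≤ p) (hq : 1 ≤ q) (h : (p : ℤ) - q ≡ 0 [ZMOD 8]) :
    (∃ m : ℕ, p + q = 2 * m + 2 ∧ AlgIso (ClEven p q) (Mat (2 ^ m) ℝ × Mat (2 ^ m) ℝ) ∧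
      (PM8 ((p : ℤ) + q) 2 → LieIso (G p q) (GLR (2 ^ m)))) ∧
    ((p : ℤ) + q ≡ 0 [ZMOD 8] → ∃ m n : ℕ, p + q = 2 * m + 4 ∧ n = 2 ^ m ∧
      LieIso (G p q) (Onn n × Onn n)) ∧
    ((p : ℤ) + q ≡ 4 [ZMOD 8] → ∃ m n : ℕ, p + q = 2 * m + 4 ∧ n = 2 ^ m ∧
      LieIso (G p q) (SpR n × SpR n)) := by
  simp only [PM8, Int.ModEq] at h ⊢
  obtain ⟨m, hm, ⟨e⟩⟩ := (cliffordTable_algIso_clEven (p := p) hq).2.1 (by omega)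
  refine ⟨⟨m, hm, ⟨e.trans (matrixProdStarAlgEquiv _ ℝ ℝ).toAlgEquiv⟩, fun h' => ?_⟩,
    fun h' => ?_, fun h' => ?_⟩
  · obtain ⟨k, hk, iso⟩ := exists_lieIso_G_GLR (p := p) (q := q) (by grind) h
    obtain rfl : m = k := by omega
    exact iso
  all_goals
    obtain ⟨d, r, even_r, hd, table⟩ := exists_hasClassicalType_G hp hq (by grind)
    obtain ⟨k, hk, iso, iso'⟩ := table.real_prod (by omega)
    refine ⟨k, _, by omega, rfl, ?_⟩
  · exact iso (prodSign_one_eq_one (by grind))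
  · exact iso' (prodSign_one_eq_neg_one (by grind))

theorem classification_of_sub_modEq_one (hp : 1 ≤ p) (hq : 1 ≤ q) (h : PM8 ((p : ℤ) - q) 1) :
    ∃ m n : ℕ, p + q = 2 * m + 3 ∧ n = 2 ^ m ∧ AlgIso (ClEven p q) (Mat (2 * n) ℝ) ∧
      (PM8 ((p : ℤ) + q) 1 → LieIso (G p q) (Onn n)) ∧
      (PM8 ((p : ℤ) + q) 3 → LieIso (G p q) (SpR n)) := by
  simp only [PM8, Int.ModEq] at h ⊢
  obtain ⟨k, hk, e⟩ := (cliffordTable_algIso_clEven (p := p) hq).1 (by omega)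
  obtain ⟨d, r, even_r, hd, table⟩ := exists_hasClassicalType_G hp hq (by grind)
  obtain ⟨m, hm, iso, iso'⟩ := table.real (by omega)
  obtain rfl : k = m + 1 := by omega
  rw [pow_succ'] at e
  exact ⟨m, _, by omega, rfl, e, fun h' => iso (prodSign_one_eq_one (by grind)),
    fun h' => iso' (prodSign_one_eq_neg_one (by grind))⟩

theorem classification_of_sub_modEq_two (hp : 1 ≤ p) (hq : 1 ≤ q) (h : PM8 ((p : ℤ) - q) 2) :
    ∃ m n : ℕ, p + q = 2 * m + 4 ∧ n = 2 ^ m ∧ AlgIso (ClEven p q) (Mat (2 * n) ℂ) ∧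
      ((p : ℤ) + q ≡ 0 [ZMOD 8] → LieIso (G p q) (OC (2 * n))) ∧
      (PM8 ((p : ℤ) + q) 2 → LieIso (G p q) (Unn n)) ∧
      ((p : ℤ) + q ≡ 4 [ZMOD 8] → LieIso (G p q) (SpC n)) := by
  simp only [PM8, Int.ModEq] at h ⊢
  obtain ⟨k, hk, e⟩ := (cliffordTable_algIso_clEven (p := p) hq).2.2.1 (by omega)
  obtain ⟨m, rfl⟩ : ∃ m, k = m + 1 := ⟨k - 1, by omega⟩
  rw [pow_succ'] at e
  refine ⟨m, _, by omega, rfl, e, fun h' => ?_, fun h' => ?_, fun h' => ?_⟩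
  · obtain ⟨l, hl, iso, -⟩ := exists_lieIso_G_OC_SpC (p := p) (q := q) (by grind) (by omega)
    obtain rfl : m = l := by omega
    exact iso (by omega)
  · obtain ⟨d, r, -, hd, table⟩ := exists_hasClassicalType_G hp hq (by grind)
    obtain ⟨l, hl, iso⟩ := table.complex (by omega)
    obtain rfl : m = l := by omega
    exact iso (prodSign_one_eq_or r)
  · obtain ⟨l, hl, -, iso⟩ := exists_lieIso_G_OC_SpC (p := p) (q := q) (by grind) (by omega)
    obtain rfl : m = l := by omega
    exact iso (by omega)

theorem classification_of_sub_modEq_three (hp : 1 ≤ p) (hq : 1 ≤ q) (h : PM8 ((p : ℤ) - q) 3) :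
    ∃ m n : ℕ, p + q = 2 * m + 5 ∧ n = 2 ^ m ∧ AlgIso (ClEven p q) (Mat (2 * n) ℍ[ℝ]) ∧
      (PM8 ((p : ℤ) + q) 1 → LieIso (G p q) (OStar (2 * n))) ∧
      (PM8 ((p : ℤ) + q) 3 → LieIso (G p q) (Spnn n)) := by
  simp only [PM8, Int.ModEq] at h ⊢
  obtain ⟨k, hk, e⟩ := (cliffordTable_algIso_clEven (p := p) hq).2.2.2.1 (by omega)
  obtain ⟨d, r, even_r, hd, table⟩ := exists_hasClassicalType_G hp hq (by grind)
  obtain ⟨m, hm, iso, iso'⟩ := table.quaternion (by omega)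
  obtain rfl : k = m + 1 := by omega
  rw [pow_succ'] at e
  exact ⟨m, _, by omega, rfl, e, fun h' => iso' (prodSign_one_eq_neg_one (by grind)),
    fun h' => iso (prodSign_one_eq_one (by grind))⟩

theorem classification_of_sub_modEq_four (hp : 1 ≤ p) (hq : 1 ≤ q) (h : (p : ℤ) - q ≡ 4 [ZMOD 8]) :
    ∃ m n : ℕ, p + q = 2 * m + 6 ∧ n = 2 ^ m ∧
      AlgIso (ClEven p q) (Mat (2 * n) ℍ[ℝ] × Mat (2 * n) ℍ[ℝ]) ∧
      ((p : ℤ) + q ≡ 0 [ZMOD 8] → LieIso (G p q) (OStar (2 * n) × OStar (2 * n))) ∧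
      (PM8 ((p : ℤ) + q) 2 → LieIso (G p q) (GLH (2 * n))) ∧
      ((p : ℤ) + q ≡ 4 [ZMOD 8] → LieIso (G p q) (Spnn n × Spnn n)) := by
  simp only [PM8, Int.ModEq] at h ⊢
  obtain ⟨k, hk, ⟨e⟩⟩ := (cliffordTable_algIso_clEven (p := p) hq).2.2.2.2 (by omega)
  obtain ⟨m, rfl⟩ : ∃ m, k = m + 1 := ⟨k - 1, by omega⟩
  have algIso := Nonempty.intro (e.trans (matrixProdStarAlgEquiv _ ℍ[ℝ] ℍ[ℝ]).toAlgEquiv)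
  rw [pow_succ'] at algIso
  refine ⟨m, _, by omega, rfl, algIso, fun h' => ?_, fun h' => ?_, fun h' => ?_⟩
  · obtain ⟨d, r, even_r, hd, table⟩ := exists_hasClassicalType_G hp hq (by grind)
    obtain ⟨l, hl, -, iso⟩ := table.quaternion_prod (by omega)
    obtain rfl : m = l := by omega
    exact iso (prodSign_one_eq_neg_one (by grind))
  · obtain ⟨l, hl, iso⟩ := exists_lieIso_G_GLH (p := p) (q := q) (by grind) h
    obtain rfl : l = m + 1 := by omega
    rwa [pow_succ'] at iso
  · obtain ⟨d, r, even_r, hd, table⟩ := exists_hasClassicalType_G hp hq (by grind)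
    obtain ⟨l, hl, iso, -⟩ := table.quaternion_prod (by omega)
    obtain rfl : m = l := by omega
    exact iso (prodSign_one_eq_one (by grind))

theorem classification_of_odd (hq : Odd q) :
    ((p : ℤ) - q ≡ 0 [ZMOD 8] → PM8 ((p : ℤ) + q) 2 ∧
      ∃ m n : ℕ, p + q = 2 * m + 2 ∧ n = 2 ^ m ∧ LieIso (G p q) (GLR n)) ∧
    ((p : ℤ) - q ≡ 4 [ZMOD 8] → PM8 ((p : ℤ) + q) 2 ∧
      ∃ m n : ℕ, p + q = 2 * m + 4 ∧ n = 2 ^ m ∧ LieIso (G p q) (GLH n)) ∧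
    (PM8 ((p : ℤ) - q) 2 → (p : ℤ) + q ≡ 0 [ZMOD 8] →
      ∃ m n : ℕ, p + q = 2 * m + 2 ∧ n = 2 ^ m ∧ LieIso (G p q) (OC n)) ∧
    (PM8 ((p : ℤ) - q) 2 → (p : ℤ) + q ≡ 4 [ZMOD 8] →
      ∃ m n : ℕ, p + q = 2 * m + 4 ∧ n = 2 ^ m ∧ LieIso (G p q) (SpC n)) := by
  simp only [PM8, Int.ModEq]
  refine ⟨fun h => ?_, fun h => ?_, fun _ h => ?_, fun _ h => ?_⟩
  · obtain ⟨m, hm, iso⟩ := exists_lieIso_G_GLR hq h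
    exact ⟨by grind, m, _, hm, rfl, iso⟩
  · obtain ⟨m, hm, iso⟩ := exists_lieIso_G_GLH hq h
    exact ⟨by grind, m, _, hm, rfl, iso⟩
  · obtain ⟨m, hm, iso, -⟩ := exists_lieIso_G_OC_SpC (p := p) hq (by omega)
    exact ⟨m + 1, _, by omega, rfl, by rw [pow_succ']; exact iso (by omega)⟩
  · obtain ⟨m, hm, -, iso⟩ := exists_lieIso_G_OC_SpC (p := p) hq (by omega)
    exact ⟨m, _, hm, rfl, iso (by omega)⟩

end Tables

end IndefClifford

end

open IndefClifford in
theorem mainTheorem9 (p q : ℕ) (hp : 1 ≤ p) (hq : 1 ≤ q) :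
    -- The structure of `G(p,q)` and of `C_even(p,q)`.
    (((p : ℤ) - q ≡ 0 [ZMOD 8] →
        (∃ m : ℕ, p + q = 2 * m + 2 ∧
          AlgIso (ClEven p q) (Mat (2 ^ m) ℝ × Mat (2 ^ m) ℝ) ∧
          (PM8 ((p : ℤ) + q) 2 → LieIso (G p q) (GLR (2 ^ m)))) ∧
        ((p : ℤ) + q ≡ 0 [ZMOD 8] → ∃ m n : ℕ, p + q = 2 * m + 4 ∧ n = 2 ^ m ∧
          LieIso (G p q) (Onn n × Onn n)) ∧
        ((p : ℤ) + q ≡ 4 [ZMOD 8] → ∃ m n : ℕ, p + q = 2 * m + 4 ∧ n = 2 ^ m ∧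
          LieIso (G p q) (SpR n × SpR n))) ∧
      (PM8 ((p : ℤ) - q) 1 → ∃ m n : ℕ, p + q = 2 * m + 3 ∧ n = 2 ^ m ∧
        AlgIso (ClEven p q) (Mat (2 * n) ℝ) ∧
        (PM8 ((p : ℤ) + q) 1 → LieIso (G p q) (Onn n)) ∧
        (PM8 ((p : ℤ) + q) 3 → LieIso (G p q) (SpR n))) ∧
      (PM8 ((p : ℤ) - q) 2 → ∃ m n : ℕ, p + q = 2 * m + 4 ∧ n = 2 ^ m ∧
        AlgIso (ClEven p q) (Mat (2 * n) ℂ) ∧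
        ((p : ℤ) + q ≡ 0 [ZMOD 8] → LieIso (G p q) (OC (2 * n))) ∧
        (PM8 ((p : ℤ) + q) 2 → LieIso (G p q) (Unn n)) ∧
        ((p : ℤ) + q ≡ 4 [ZMOD 8] → LieIso (G p q) (SpC n))) ∧
      (PM8 ((p : ℤ) - q) 3 → ∃ m n : ℕ, p + q = 2 * m + 5 ∧ n = 2 ^ m ∧
        AlgIso (ClEven p q) (Mat (2 * n) ℍ[ℝ]) ∧
        (PM8 ((p : ℤ) + q) 1 → LieIso (G p q) (OStar (2 * n))) ∧
        (PM8 ((p : ℤ) + q) 3 → LieIso (G p q) (Spnn n))) ∧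
      ((p : ℤ) - q ≡ 4 [ZMOD 8] → ∃ m n : ℕ, p + q = 2 * m + 6 ∧ n = 2 ^ m ∧
        AlgIso (ClEven p q) (Mat (2 * n) ℍ[ℝ] × Mat (2 * n) ℍ[ℝ]) ∧
        ((p : ℤ) + q ≡ 0 [ZMOD 8] → LieIso (G p q) (OStar (2 * n) × OStar (2 * n))) ∧
        (PM8 ((p : ℤ) + q) 2 → LieIso (G p q) (GLH (2 * n))) ∧
        ((p : ℤ) + q ≡ 4 [ZMOD 8] → LieIso (G p q) (Spnn n × Spnn n)))) ∧
    -- The structure of `C(p,q) ∩ Aut(J₊)` and of `C(p,q) ∩ Aut(J₋)`.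
    AutTable p q (AutJ (JPlus p q))
      (p % 4 = 0 ∨ p % 4 = 1) (p % 4 = 2 ∨ p % 4 = 3) ∧
    AutTable p q (AutJ (JMinus p q))
      ((q + 1) % 4 = 0 ∨ (q + 1) % 4 = 1) ((q + 1) % 4 = 2 ∨ (q + 1) % 4 = 3) ∧
    -- The case where `p` and `q` are odd.
    (Odd p → Odd q →
      G p q = (ClEven p q).toSubmonoid ⊓ AutJ (JPlus p q) ∧
      G p q = (ClEven p q).toSubmonoid ⊓ AutJ (JMinus p q) ∧
      ((p : ℤ) - q ≡ 0 [ZMOD 8] → PM8 ((p : ℤ) + q) 2 ∧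
        ∃ m n : ℕ, p + q = 2 * m + 2 ∧ n = 2 ^ m ∧ LieIso (G p q) (GLR n)) ∧
      ((p : ℤ) - q ≡ 4 [ZMOD 8] → PM8 ((p : ℤ) + q) 2 ∧
        ∃ m n : ℕ, p + q = 2 * m + 4 ∧ n = 2 ^ m ∧ LieIso (G p q) (GLH n)) ∧
      (PM8 ((p : ℤ) - q) 2 → (p : ℤ) + q ≡ 0 [ZMOD 8] →
        ∃ m n : ℕ, p + q = 2 * m + 2 ∧ n = 2 ^ m ∧ LieIso (G p q) (OC n)) ∧
      (PM8 ((p : ℤ) - q) 2 → (p : ℤ) + q ≡ 4 [ZMOD 8] →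
        ∃ m n : ℕ, p + q = 2 * m + 4 ∧ n = 2 ^ m ∧ LieIso (G p q) (SpC n))) := by
  exact ⟨⟨classification_of_sub_modEq_zero hp hq, classification_of_sub_modEq_one hp hq,
      classification_of_sub_modEq_two hp hq, classification_of_sub_modEq_three hp hq,
      classification_of_sub_modEq_four hp hq⟩,
    autTable_JPlus hp hq, autTable_JMinus hp hq, fun _ odd_q =>
      ⟨G_eq_inf_JPlus hp hq, G_eq_inf_JMinus hp hq, classification_of_odd odd_q⟩⟩
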